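/- Let $F=\mathbb{F}_q$ be a finite field with $q$ elements. **Partial isomorphisms.** A partial isomorphism of $F^n$ is a pair of linear isomorphisms $g_1:V\to W$, $g_2:W\to V$ between two subspaces of $F^n$; it is written $(V\,|\,g_1\rightleftarrows g_2\,|\,W)$ and its degree is $\dim V$. An extension of it is a partial isomorphism $(V^+|g_1^+\rightleftarrows g_2^+|W^+)$ with $V\subset V^+$, $W\subset W^+$, $g_1^+|_V=g_1$, $g_2^+|_W=g_2$; it is trivial if $V^+=V\oplus A$, $W^+=W\oplus B$, $g_1^+=g_1\oplus\psi$, $g_2^+=g_2\oplus\psi^{-1}$ for some isomorphism $\psi:A\to B$. Let $\mathscr{A}(n,F)$ be the complex vector space with basis the partial isomorphisms of $F^n$, with the bilinear product for which $(U|g_1\rightleftarrows g_2|V)*(W|h_1\rightleftarrows h_2|X)$ is the mean of the $(U^+\,|\,h_1^+\circ g_1^+\rightleftarrows g_2^+\circ h_2^+\,|\,X^+)$ over all pairs consisting of a trivial extension $(U^+|g_1^+\rightleftarrows g_2^+|V+W)$ of the first factor and a trivial extension $(V+W|h_1^+\rightleftarrows h_2^+|X^+)$ of the second factor. Let $\mathscr{Z}(n,F)\subset\mathscr{A}(n,F)$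 be the subspace of elements invariant under the left and right actions of $\mathrm{GL}(n,F)$ on partial isomorphisms (by transport of the left, respectively of the right, subspace). **The projective limit.** Write $(q^{-1})_m=\prod_{i=1}^m(1-q^{-i})$. For $n\le m$ let $\phi_n^m:\mathscr{A}(m,F)\to\mathscr{A}(n,F)$ be the linear map sending a partial isomorphism of degree $k$ to $q^{(m-n)k}\frac{(q^{-1})_m(q^{-1})_{n-k}}{(q^{-1})_{m-k}(q^{-1})_n}$ times itself if both its subspaces lie in $F^n\subset F^m$, and to $0$ otherwise. $\mathscr{Z}(\infty,F)$ is the space of sequences $(x_n)_n$ with $x_n\in\mathscr{Z}(n,F)$, $\phi^m_n(x_m)=x_n$ for $n\le m$, and terms of bounded degree; products are taken termwise. **Generic classes.** A polypartition $\mu$ is a family of partitions $\mu(P)$ labelled by finitely many monic irreducible polynomials $P\ne X$ over $F$, of size $|\mu|=\sum_P \deg P\,|\mu(P)|$; $J(\mu)$ is the block-diagonal matrix with blocks the companion matrices of the $P^{\mu(P)_j}$. For $k=|\mu|\le n$ put $$\widehat A_{\mu,n}=\frac{(q^{-1})_{n-k}}{q^{nk}(q^{-1})_n}\sum_{(e_1,\dots,e_k),\,(f_1,\dots,f_k)\text{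 free}}\bigl(\mathrm{Span}(e)\,|\,I_k\rightleftarrows J(\mu)\,|\,\mathrm{Span}(f)\bigr),$$ the matrices being taken with respect to the bases $e$ and $f$, and $\widehat A_{\mu,n}=0$ if $k>n$. The generic class $\widehat A_\mu=(\widehat A_{\mu,n})_n$ is an element of $\mathscr{Z}(\infty,F)$. Partitions are written $\{P:2\}$, $\{P:1^2\}$, $\{P:1,Q:1\}$, and $\widehat A_{X-a}=\widehat A_{\{X-a:1\}}$. For $b\in F^\times$ let $I_b=\{c\in F : X^2+cX+b\text{ is irreducible}\}$. **Theorem.** Let $a,b\in F^\times$. The product $\widehat A_{X-a}*\widehat A_{X-b}$ is as follows. 1. If $a\ne b$, $a\neq 1$, $b\ne1$, $q$ is odd and $ab=\delta^2$ with $\delta\in F^\times$: $$\tfrac{q-1}{q^2}\Bigl(\widehat A_{\{X-\delta:2\}}+\widehat A_{\{X+\delta:2\}}+\sum_{c\in I_{ab}}\widehat A_{\{X^2+cX+ab:1\}}+\tfrac12\sum_{d\in F^\times\setminus\{1,b^{-1}a,\pm b^{-1}\delta\}}\widehat A_{\{X-ad^{-1}:1,X-bd:1\}}\Bigr)+\tfrac{2q-1}{q^2}\widehat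 A_{\{X-a:1,X-b:1\}}+(q-1)\widehat A_{X-ab}.$$ 2. If $a\ne b$, $a\neq 1$, $b\ne1$, $q$ is odd and $ab$ is not a square: $$\tfrac{q-1}{q^2}\Bigl(\sum_{c\in I_{ab}}\widehat A_{\{X^2+cX+ab:1\}}+\tfrac12\sum_{d\in F^\times\setminus\{1,b^{-1}a\}}\widehat A_{\{X-ad^{-1}:1,X-bd:1\}}\Bigr)+\tfrac{2q-1}{q^2}\widehat A_{\{X-a:1,X-b:1\}}+(q-1)\widehat A_{X-ab}.$$ 3. If $a\ne b$, $a\neq 1$, $b\ne1$, $q$ is even and $\delta=(ab)^{q/2}$: $$\tfrac{q-1}{q^2}\Bigl(\widehat A_{\{X-\delta:2\}}+\sum_{c\in I_{ab}}\widehat A_{\{X^2+cX+ab:1\}}+\tfrac12\sum_{d\in F^\times\setminus\{1,b^{-1}a,b^{-1}\delta\}}\widehat A_{\{X-ad^{-1}:1,X-bd:1\}}\Bigr)+\tfrac{2q-1}{q^2}\widehat A_{\{X-a:1,X-b:1\}}+(q-1)\widehat A_{X-ab}.$$ 4. If $a=b\ne1$ and $q$ is odd: $$\tfrac{q-1}{q^2}\Bigl(2\widehat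 A_{\{X-a:2\}}+\widehat A_{\{X+a:2\}}+\sum_{c\in I_{a^2}}\widehat A_{\{X^2+cX+a^2:1\}}+\tfrac12\sum_{d\in F^\times\setminus\{\pm1\}}\widehat A_{\{X-ad^{-1}:1,X-ad:1\}}\Bigr)+\tfrac1{q^2}\widehat A_{\{X-a:1^2\}}+(q-1)\widehat A_{X-a^2}.$$ 5. If $a=b\ne1$ and $q$ is even: $$\tfrac{q-1}{q^2}\Bigl(2\widehat A_{\{X-a:2\}}+\sum_{c\in I_{a^2}}\widehat A_{\{X^2+cX+a^2:1\}}+\tfrac12\sum_{d\in F^\times\setminus\{1\}}\widehat A_{\{X-ad^{-1}:1,X-ad:1\}}\Bigr)+\tfrac1{q^2}\widehat A_{\{X-a:1^2\}}+(q-1)\widehat A_{X-a^2}.$$ 6. If $a\ne1$ and $b=1$: $\widehat A_{\{X-a:1,X-1:1\}}+(q-1)\widehat A_{X-a}$; the product $\widehat A_{X-1}*\widehat A_{X-a}$ has the same value. 7. If $a=b=1$: $\widehat A_{\{X-1:1^2\}}+(q-1)\widehat A_{X-1}$. -/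

import Mathlib

open Polynomial

noncomputable section

/-- A partial isomorphism of `F ^ n`: a pair of isomorphisms `V → W` and `W → V` between two
subspaces of `F ^ n`. -/
@[ext]
structure PartialIso (F : Type*) [Field F] (n : ℕ) where
  left : Submodule F (Fin n → F)
  right : Submodule F (Fin n → F)
  fwd : left ≃ₗ[F] right
  bwd : right ≃ₗ[F] left

namespace PartialIso

variable {F : Type*} [Field F] {n : ℕ}

/-- The degree of a partial isomorphism: the common dimension of its two subspaces. -/
def degree (I : PartialIso F n) : ℕ := Module.finrank F I.left

/-- The composition of arrows `U → V → X` and `X → V → U`, when the right subspace of `I` is the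
left subspace of `J`. -/
def comp (I J : PartialIso F n) (h : I.right = J.left) : PartialIso F n where
  left := I.left
  right := J.right
  fwd := (I.fwd.trans (LinearEquiv.ofEq _ _ h)).trans J.fwd
  bwd := (J.bwd.trans (LinearEquiv.ofEq _ _ h.symm)).trans I.bwd

/-- `J` extends `I`. -/
def IsExtension (I J : PartialIso F n) : Prop :=
  I.left ≤ J.left ∧ I.right ≤ J.right ∧
  (∀ (x : I.left) (y : J.left), (x : Fin n → F) = y → (I.fwd x : Fin n → F) = J.fwd y) ∧
  (∀ (x : I.right) (y : J.right), (x : Fin n → F) = y → (I.bwd x : Fin n → F) = J.bwd y)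

/-- `J` is a trivial extension of `I`: there are decompositions `V⁺ = V ⊕ A` and `W⁺ = W ⊕ B` such
that `g₁⁺ = g₁ ⊕ ψ` and `g₂⁺ = g₂ ⊕ ψ⁻¹` for an isomorphism `ψ` from `A` to `B`. -/
def IsTrivialExtension (I J : PartialIso F n) : Prop :=
  IsExtension I J ∧
  ∃ A B : Submodule F (Fin n → F),
    Disjoint I.left A ∧ I.left ⊔ A = J.left ∧
    Disjoint I.right B ∧ I.right ⊔ B = J.right ∧
    (∀ x : J.left, (x : Fin n → F) ∈ A → (J.fwd x : Fin n → F) ∈ B ∧ J.bwd (J.fwd x) = x) ∧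
    (∀ y : J.right, (y : Fin n → F) ∈ B → (J.bwd y : Fin n → F) ∈ A ∧ J.fwd (J.bwd y) = y)

/-- The trivial extensions of `I` with prescribed right subspace `Y`. -/
def RightExt (I : PartialIso F n) (Y : Submodule F (Fin n → F)) : Type _ :=
  {J : PartialIso F n // IsTrivialExtension I J ∧ J.right = Y}

/-- The trivial extensions of `I` with prescribed left subspace `Y`. -/
def LeftExt (I : PartialIso F n) (Y : Submodule F (Fin n → F)) : Type _ :=
  {J : PartialIso F n // IsTrivialExtension I J ∧ J.left = Y}

/-- The transport of a partial isomorphism by `a` on the left subspace and by `b` on the right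
subspace. With `a = k⁻¹` and `b = l⁻¹` this is the double action
`k · (V | g₁ ⇌ g₂ | W) · l = (k⁻¹ V | k g₁ l⁻¹ ⇌ l g₂ k⁻¹ | l⁻¹ W)`, where products of
isomorphisms are read from left to right. -/
def act (a b : (Fin n → F) ≃ₗ[F] (Fin n → F)) (I : PartialIso F n) : PartialIso F n where
  left := I.left.map (a : (Fin n → F) →ₗ[F] (Fin n → F))
  right := I.right.map (b : (Fin n → F) →ₗ[F] (Fin n → F))
  fwd := ((a.submoduleMap I.left).symm.trans I.fwd).trans (b.submoduleMap I.right)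
  bwd := ((b.submoduleMap I.right).symm.trans I.bwd).trans (a.submoduleMap I.left)

/-- The inclusion of `F ^ n` in `F ^ m` (on the first `n` coordinates) for `n ≤ m`. -/
def incl {n m : ℕ} (h : n ≤ m) : (Fin n → F) →ₗ[F] (Fin m → F) :=
  Function.ExtendByZero.linearMap F (Fin.castLE h)

theorem incl_injective {n m : ℕ} (h : n ≤ m) : Function.Injective (incl (F := F) h) :=
  fun _ _ hxy => Function.extend_injective (Fin.castLE_injective h) (0 : Fin m → F) hxy

/-- A partial isomorphism of `F ^ n` seen as a partial isomorphism of `F ^ m`, for `n ≤ m`. -/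
def push {n m : ℕ} (h : n ≤ m) (I : PartialIso F n) : PartialIso F m where
  left := I.left.map (incl h)
  right := I.right.map (incl h)
  fwd := ((Submodule.equivMapOfInjective _ (incl_injective h) I.left).symm.trans I.fwd).trans
    (Submodule.equivMapOfInjective _ (incl_injective h) I.right)
  bwd := ((Submodule.equivMapOfInjective _ (incl_injective h) I.right).symm.trans I.bwd).trans
    (Submodule.equivMapOfInjective _ (incl_injective h) I.left)

/-- With respect to the families `e` and `f`, assumed to be free, `I` is
`(Span e | 1 ⇌ M | Span f)`: the first arrow sends `e i` to `f i`, and the matrix of the second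
arrow from the basis `f` to the basis `e` is `M`. -/
def HasForm {ι : Type*} [Fintype ι] (e f : ι → Fin n → F) (M : Matrix ι ι F)
    (I : PartialIso F n) : Prop :=
  I.left = Submodule.span F (Set.range e) ∧ I.right = Submodule.span F (Set.range f) ∧
  (∀ (i : ι) (x : I.left), (x : Fin n → F) = e i → (I.fwd x : Fin n → F) = f i) ∧
  (∀ (j : ι) (y : I.right), (y : Fin n → F) = f j →
    (I.bwd y : Fin n → F) = ∑ i, M i j • e i)

instance instFinite [Finite F] : Finite (PartialIso F n) := by
  have : Finite (Submodule F (Fin n → F)) :=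
    Finite.of_injective (fun V => (V : Set (Fin n → F))) SetLike.coe_injective
  have : ∀ V W : Submodule F (Fin n → F), Finite (V ≃ₗ[F] W) := fun V W =>
    Finite.of_injective (fun g => (g : V → W)) DFunLike.coe_injective
  refine Finite.of_injective
    (β := Σ p : Submodule F (Fin n → F) × Submodule F (Fin n → F),
      (p.1 ≃ₗ[F] p.2) × (p.2 ≃ₗ[F] p.1))
    (fun I => ⟨(I.left, I.right), (I.fwd, I.bwd)⟩) ?_
  rintro ⟨V, W, g, h⟩ ⟨V', W', g', h'⟩ H
  simp only [Sigma.mk.injEq, Prod.mk.injEq] at H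
  obtain ⟨⟨rfl, rfl⟩, H⟩ := H
  simp at H
  obtain ⟨rfl, rfl⟩ := H
  rfl

instance instFintype [Finite F] : Fintype (PartialIso F n) := Fintype.ofFinite _

instance [Finite F] (I : PartialIso F n) (Y : Submodule F (Fin n → F)) :
    Fintype (RightExt I Y) :=
  haveI : Finite (RightExt I Y) := inferInstanceAs (Finite {_J : PartialIso F n // _})
  Fintype.ofFinite _

instance [Finite F] (I : PartialIso F n) (Y : Submodule F (Fin n → F)) :
    Fintype (LeftExt I Y) :=
  haveI : Finite (LeftExt I Y) := inferInstanceAs (Finite {_J : PartialIso F n // _})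
  Fintype.ofFinite _

end PartialIso

/-- The complex vector space with basis the set of partial isomorphisms of `F ^ n`. -/
def PartIsoAlg (F : Type*) [Field F] (n : ℕ) : Type _ := PartialIso F n →₀ ℂ

namespace PartIsoAlg

variable {F : Type*} [Field F] {n : ℕ}

instance : AddCommGroup (PartIsoAlg F n) := inferInstanceAs (AddCommGroup (PartialIso F n →₀ ℂ))

instance : Module ℂ (PartIsoAlg F n) := inferInstanceAs (Module ℂ (PartialIso F n →₀ ℂ))

/-- The basis element attached to a partial isomorphism. -/
def of (I : PartialIso F n) : PartIsoAlg F n := Finsupp.single I 1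

/-- The coefficient of a partial isomorphism in an element of the algebra. -/
def coeff (I : PartialIso F n) : PartIsoAlg F n →ₗ[ℂ] ℂ := Finsupp.lapply I

/-- The linear extension of a map defined on partial isomorphisms. -/
def lift {M : Type*} [AddCommGroup M] [Module ℂ M] (v : PartialIso F n → M) :
    PartIsoAlg F n →ₗ[ℂ] M := Finsupp.linearCombination ℂ v

/-- The product of the partial isomorphisms `(U | V)` and `(W | X)`: the mean of all the
compositions of a trivial extension of the first one with right subspace `V + W` and of a trivial
extension of the second one with left subspace `V + W`. -/
def mulBasis [Finite F] (I J : PartialIso F n) : PartIsoAlg F n :=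
  ((Fintype.card (I.RightExt (I.right ⊔ J.left)) : ℂ)⁻¹ *
    (Fintype.card (J.LeftExt (I.right ⊔ J.left)) : ℂ)⁻¹) •
  ∑ P : I.RightExt (I.right ⊔ J.left), ∑ Q : J.LeftExt (I.right ⊔ J.left),
    of (P.1.comp Q.1 (P.2.2.trans Q.2.2.symm))

/-- The bilinear extension of the product of partial isomorphisms. -/
def mulLin [Finite F] : PartIsoAlg F n →ₗ[ℂ] PartIsoAlg F n →ₗ[ℂ] PartIsoAlg F n :=
  lift fun I => lift fun J => mulBasis I J

instance [Finite F] : Mul (PartIsoAlg F n) := ⟨fun x y => mulLin x y⟩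

variable (F n) in
/-- The space of invariants in the algebra of partial isomorphisms of `F ^ n`, for the actions of
the linear group on the left and on the right. -/
def invariants : Submodule ℂ (PartIsoAlg F n) where
  carrier := {x | ∀ (a b : (Fin n → F) ≃ₗ[F] (Fin n → F)) (I : PartialIso F n),
    coeff (I.act a b) x = coeff I x}
  add_mem' hx hy a b I := by simp only [map_add, hx a b I, hy a b I]
  zero_mem' a b I := by simp only [map_zero]
  smul_mem' c x hx a b I := by simp only [map_smul, hx a b I]

end PartIsoAlg

/-- The Pochhammer symbol `(q⁻¹)_m = (1 - q⁻¹) (1 - q⁻²) ⋯ (1 - q⁻ᵐ)`. -/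
def pochInv (q : ℂ) (m : ℕ) : ℂ := ∏ i ∈ Finset.range m, (1 - (q ^ (i + 1))⁻¹)

section limit

variable {F : Type*} [Field F] [Fintype F]

open Classical in
/-- The map from the algebra of partial isomorphisms of `F ^ m` to that of `F ^ n`, for `n ≤ m`: it
sends a partial isomorphism of degree `k` to
`q ^ ((m - n) k) (q⁻¹)_m (q⁻¹)_{n-k} / ((q⁻¹)_{m-k} (q⁻¹)_n)` times itself if its two subspaces are
contained in `F ^ n` (hence if it comes from a unique partial isomorphism of `F ^ n`), and to zero
otherwise. -/
def transition {n m : ℕ} (h : n ≤ m) : PartIsoAlg F m →ₗ[ℂ] PartIsoAlg F n :=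
  PartIsoAlg.lift fun I => ∑ I' : PartialIso F n, if I'.push h = I then
    ((Fintype.card F : ℂ) ^ ((m - n) * I.degree) *
      (pochInv (Fintype.card F) m * pochInv (Fintype.card F) (n - I.degree)) /
      (pochInv (Fintype.card F) (m - I.degree) * pochInv (Fintype.card F) n)) •
      PartIsoAlg.of I' else 0

variable (F) in
/-- The projective limit, in the graded sense, of the spaces of invariants: the sequences
`(x_n)` of invariants that are compatible with the transition maps and whose terms have bounded
degree. It is contained in the product of all the algebras of partial isomorphisms, where sequences
are multiplied termwise. -/
def GenericAlg : Submodule ℂ (∀ n, PartIsoAlg F n) where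
  carrier := {x | (∀ n, x n ∈ PartIsoAlg.invariants F n) ∧
    (∀ (n m : ℕ) (h : n ≤ m), transition h (x m) = x n) ∧
    ∃ d : ℕ, ∀ (n : ℕ) (I : PartialIso F n), d < I.degree → PartIsoAlg.coeff I (x n) = 0}
  add_mem' := by
    rintro x y ⟨hx, hx', d, hd⟩ ⟨hy, hy', d', hd'⟩
    refine ⟨fun n => add_mem (hx n) (hy n), fun n m h => ?_, max d d', fun n I hI => ?_⟩
    · simp only [Pi.add_apply, map_add, hx' n m h, hy' n m h]
    · simp only [Pi.add_apply, map_add, hd n I (lt_of_le_of_lt (le_max_left _ _) hI),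
        hd' n I (lt_of_le_of_lt (le_max_right _ _) hI), add_zero]
  zero_mem' := ⟨fun n => zero_mem _, fun n m h => by simp only [Pi.zero_apply, map_zero],
    0, fun n I _ => by simp only [Pi.zero_apply, map_zero]⟩
  smul_mem' := by
    rintro c x ⟨hx, hx', d, hd⟩
    refine ⟨fun n => Submodule.smul_mem _ c (hx n), fun n m h => ?_, d, fun n I hI => ?_⟩
    · simp only [Pi.smul_apply, map_smul, hx' n m h]
    · simp only [Pi.smul_apply, map_smul, hd n I hI, smul_zero]

end limit

/-- The monic irreducible polynomials different from `X`. -/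
def PolyLabel (F : Type*) [Field F] : Type _ := {P : F[X] // P.Monic ∧ Irreducible P ∧ P ≠ X}

/-- A polypartition, that is a family of partitions labelled by monic irreducible polynomials
different from `X`, is encoded as the multiset of the pairs `(P, i)`, where `i` runs over the parts
of the partition labelled by `P`. -/
abbrev Polypartition (F : Type*) [Field F] : Type _ := Multiset (PolyLabel F × ℕ+)

/-- The Jordan (companion) matrix of a monic polynomial: ones below the diagonal, and the opposites
of the coefficients of the polynomial in the last column. -/
def jordanBlock {F : Type*} [Field F] (P : F[X]) :
    Matrix (Fin P.natDegree) (Fin P.natDegree) F := fun i j =>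
  if (j : ℕ) + 1 = P.natDegree then -P.coeff i else if (i : ℕ) = (j : ℕ) + 1 then 1 else 0

namespace Polypartition

variable {F : Type*} [Field F]

instance : DecidableEq (PolyLabel F) := Classical.decEq _

instance (μ : Polypartition F) : DecidableEq μ.ToType := Classical.decEq _

/-- The polynomial `P ^ i` attached to a part `i` of the partition labelled by `P`. -/
def block (μ : Polypartition F) (x : μ.ToType) : F[X] := x.1.1.1 ^ (x.1.2 : ℕ)

/-- The index set of the rows and columns of the Jordan matrix of a polypartition. -/
abbrev Index (μ : Polypartition F) : Type _ := Σ x : μ.ToType, Fin (μ.block x).natDegree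

/-- The size of a polypartition, that is the sum of `deg P` times the size of the partition
labelled by `P`. -/
def size (μ : Polypartition F) : ℕ := (μ.map fun x => x.1.1.natDegree * (x.2 : ℕ)).sum

/-- The Jordan matrix of a polypartition, block diagonal with blocks the Jordan matrices of the
polynomials `P ^ i`. -/
def jordan (μ : Polypartition F) : Matrix μ.Index μ.Index F :=
  Matrix.blockDiagonal' fun x => jordanBlock (μ.block x)

theorem card_index (μ : Polypartition F) : Fintype.card μ.Index = μ.size := by
  have h : ∀ x : μ.ToType, (μ.block x).natDegree = x.1.1.1.natDegree * (x.1.2 : ℕ) := fun x => by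
    rw [block, (x.1.1.2.1).natDegree_pow, mul_comm]
  rw [Fintype.card_sigma, size]
  simp only [Fintype.card_fin, h]
  exact congrArg Multiset.sum (Multiset.map_univ μ fun x => x.1.1.natDegree * (x.2 : ℕ))

end Polypartition

section classes

variable {F : Type*} [Field F]

namespace PartialIso

theorem HasForm.degree_eq {n : ℕ} {ι : Type*} [Fintype ι] {e f : ι → Fin n → F}
    {M : Matrix ι ι F} {I : PartialIso F n} (h : I.HasForm e f M) (he : LinearIndependent F e) :
    I.degree = Fintype.card ι := by
  rw [degree, h.1, finrank_span_eq_card he]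

/-- Pushing a partial isomorphism along injective linear maps `a` and `b`, characterized by its
values, pushes its matrix forms. -/
theorem hasForm_iff_of_map {n m : ℕ} {ι : Type*} [Fintype ι] (e f : ι → Fin n → F)
    (M : Matrix ι ι F) (a b : (Fin n → F) →ₗ[F] (Fin m → F)) (ha : Function.Injective a)
    (hb : Function.Injective b) (I : PartialIso F n) (J : PartialIso F m)
    (hl : J.left = I.left.map a) (hr : J.right = I.right.map b)
    (h1 : ∀ (x : I.left) (y : J.left), (y : Fin m → F) = a x →
      (J.fwd y : Fin m → F) = b (I.fwd x))
    (h2 : ∀ (x : I.right) (y : J.right), (y : Fin m → F) = b x →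
      (J.bwd y : Fin m → F) = a (I.bwd x)) :
    J.HasForm (fun i => a (e i)) (fun i => b (f i)) M ↔ I.HasForm e f M := by
  have hra : Set.range (fun i => a (e i)) = a '' Set.range e := Set.range_comp a e
  have hrb : Set.range (fun i => b (f i)) = b '' Set.range f := Set.range_comp b f
  refine and_congr ?_ (and_congr ?_ (and_congr ?_ ?_))
  · rw [hl, hra, Submodule.span_image, (Submodule.map_injective_of_injective ha).eq_iff]
  · rw [hr, hrb, Submodule.span_image, (Submodule.map_injective_of_injective hb).eq_iff]
  · constructor
    · intro H i x hx
      have hm : a x ∈ J.left := hl ▸ Submodule.mem_map_of_mem x.2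
      have := H i ⟨a x, hm⟩ (by simp [hx])
      rw [h1 x _ rfl] at this
      exact hb this
    · intro H i y hy
      have hm : (y : Fin m → F) ∈ I.left.map a := hl ▸ y.2
      obtain ⟨x, hx, hxy⟩ := hm
      rw [h1 ⟨x, hx⟩ y hxy.symm, H i ⟨x, hx⟩ (ha (hxy.trans hy))]
  · constructor
    · intro H i x hx
      have hm : b x ∈ J.right := hr ▸ Submodule.mem_map_of_mem x.2
      have := H i ⟨b x, hm⟩ (by simp [hx])
      rw [h2 x _ rfl] at this
      apply ha
      simpa using this
    · intro H i y hy
      have hm : (y : Fin m → F) ∈ I.right.map b := hr ▸ y.2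
      obtain ⟨x, hx, hxy⟩ := hm
      rw [h2 ⟨x, hx⟩ y hxy.symm, H i ⟨x, hx⟩ (hb (hxy.trans hy))]
      simp

theorem hasForm_act {n : ℕ} {ι : Type*} [Fintype ι] (e f : ι → Fin n → F)
    (M : Matrix ι ι F) (a b : (Fin n → F) ≃ₗ[F] (Fin n → F)) (I : PartialIso F n) :
    (I.act a b).HasForm (fun i => a (e i)) (fun i => b (f i)) M ↔ I.HasForm e f M := by
  refine hasForm_iff_of_map e f M a.toLinearMap b.toLinearMap a.injective b.injective I
    (I.act a b) rfl rfl ?_ ?_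
  · intro x y hy
    obtain rfl : y = a.submoduleMap I.left x := Subtype.ext hy
    change ((b.submoduleMap I.right) (I.fwd ((a.submoduleMap I.left).symm
      (a.submoduleMap I.left x))) : Fin n → F) = _
    rw [LinearEquiv.symm_apply_apply]
    rfl
  · intro x y hy
    obtain rfl : y = b.submoduleMap I.right x := Subtype.ext hy
    change ((a.submoduleMap I.left) (I.bwd ((b.submoduleMap I.right).symm
      (b.submoduleMap I.right x))) : Fin n → F) = _
    rw [LinearEquiv.symm_apply_apply]
    rfl

theorem hasForm_push {n m : ℕ} (h : n ≤ m) {ι : Type*} [Fintype ι] (e f : ι → Fin n → F)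
    (M : Matrix ι ι F) (I : PartialIso F n) :
    (I.push h).HasForm (fun i => incl h (e i)) (fun i => incl h (f i)) M ↔ I.HasForm e f M := by
  refine hasForm_iff_of_map e f M (incl h) (incl h) (incl_injective h) (incl_injective h) I
    (I.push h) rfl rfl ?_ ?_
  · intro x y hy
    obtain rfl : y = Submodule.equivMapOfInjective _ (incl_injective h) I.left x :=
      Subtype.ext hy
    change ((Submodule.equivMapOfInjective _ (incl_injective h) I.right) (I.fwd
      ((Submodule.equivMapOfInjective _ (incl_injective h) I.left).symm
        (Submodule.equivMapOfInjective _ (incl_injective h) I.left x))) : Fin m → F) = _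
    rw [LinearEquiv.symm_apply_apply]
    rfl
  · intro x y hy
    obtain rfl : y = Submodule.equivMapOfInjective _ (incl_injective h) I.right x :=
      Subtype.ext hy
    change ((Submodule.equivMapOfInjective _ (incl_injective h) I.left) (I.bwd
      ((Submodule.equivMapOfInjective _ (incl_injective h) I.right).symm
        (Submodule.equivMapOfInjective _ (incl_injective h) I.right x))) : Fin m → F) = _
    rw [LinearEquiv.symm_apply_apply]
    rfl

end PartialIso

/-- The free families of vectors of `F ^ n` indexed by `ι`. -/
abbrev FreeFamily (F : Type*) [Field F] (n : ℕ) (ι : Type*) : Type _ :=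
  {e : ι → Fin n → F // LinearIndependent F e}

instance [Finite F] (n : ℕ) (ι : Type*) [Finite ι] : Fintype (FreeFamily F n ι) := Fintype.ofFinite _

open Classical in
/-- The class of a polypartition among the partial isomorphisms of `F ^ n`: the sum over free
families `e` and `f` of the partial isomorphisms `(Span e | 1 ⇌ J | Span f)`, where `J` is the
Jordan matrix of the polypartition. For each `e` and `f` there is one such partial isomorphism,
the matrix `J` being invertible. -/
def classSum [Fintype F] (μ : Polypartition F) (n : ℕ) : PartIsoAlg F n :=
  ∑ e : FreeFamily F n μ.Index, ∑ f : FreeFamily F n μ.Index,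
    ∑ I : PartialIso F n, if I.HasForm e.1 f.1 μ.jordan then PartIsoAlg.of I else 0

/-- The normalized class of a polypartition of size `k` among the partial isomorphisms of `F ^ n`:
the class, divided by the square root `q ^ (n k) (q⁻¹)_n / (q⁻¹)_{n-k}` of the number of its terms
if `k ≤ n`; it is zero if `k > n`. -/
def normClass [Fintype F] (μ : Polypartition F) (n : ℕ) : PartIsoAlg F n :=
  (pochInv (Fintype.card F) (n - μ.size) /
    ((Fintype.card F : ℂ) ^ (n * μ.size) * pochInv (Fintype.card F) n)) • classSum μ n

theorem PartIsoAlg.coeff_of {n : ℕ} (I J : PartialIso F n) [Decidable (J = I)] :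
    PartIsoAlg.coeff I (PartIsoAlg.of J) = if J = I then 1 else 0 := by
  classical
  change (Finsupp.single J (1 : ℂ)) I = _
  rw [Finsupp.single_apply]

/-- The pairs of free families with respect to which `I` has matrix form `M`. -/
def FormPair {n : ℕ} {ι : Type*} [Fintype ι] (M : Matrix ι ι F) (I : PartialIso F n) : Type _ :=
  {p : (ι → Fin n → F) × (ι → Fin n → F) //
    LinearIndependent F p.1 ∧ LinearIndependent F p.2 ∧ I.HasForm p.1 p.2 M}

theorem coeff_classSum [Fintype F] (μ : Polypartition F) (n : ℕ) (I : PartialIso F n) :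
    PartIsoAlg.coeff I (classSum μ n) = Nat.card (FormPair μ.jordan I) := by
  classical
  have h1 : PartIsoAlg.coeff I (classSum μ n) = ∑ e : FreeFamily F n μ.Index,
      ∑ f : FreeFamily F n μ.Index, if I.HasForm e.1 f.1 μ.jordan then (1 : ℂ) else 0 := by
    simp only [classSum, map_sum]
    refine Finset.sum_congr rfl fun e _ => Finset.sum_congr rfl fun f _ => ?_
    rw [Finset.sum_eq_single I]
    · split_ifs <;> simp [PartIsoAlg.coeff_of]
    · intro J _ hJ
      split_ifs
      · rw [PartIsoAlg.coeff_of, if_neg hJ]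
      · simp
    · simp
  rw [h1, ← Fintype.sum_prod_type' (f := fun (e f : FreeFamily F n μ.Index) =>
    if I.HasForm e.1 f.1 μ.jordan then (1 : ℂ) else 0), Finset.sum_boole]
  congr 1
  rw [← Fintype.card_subtype, ← Nat.card_eq_fintype_card]
  exact Nat.card_congr
    ⟨fun x => ⟨(x.1.1.1, x.1.2.1), x.1.1.2, x.1.2.2, x.2⟩,
      fun x => ⟨(⟨x.1.1, x.2.1⟩, ⟨x.1.2, x.2.2.1⟩), x.2.2.2⟩, fun _ => rfl, fun _ => rfl⟩

theorem card_formPair_act {n : ℕ} {ι : Type*} [Fintype ι] (M : Matrix ι ι F)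
    (a b : (Fin n → F) ≃ₗ[F] (Fin n → F)) (I : PartialIso F n) :
    Nat.card (FormPair M (I.act a b)) = Nat.card (FormPair M I) := by
  symm
  refine Nat.card_congr (Equiv.ofBijective (fun p => ⟨(fun i => a (p.1.1 i), fun i => b (p.1.2 i)),
    p.2.1.map' a.toLinearMap a.ker, p.2.2.1.map' b.toLinearMap b.ker,
    (PartialIso.hasForm_act _ _ M a b I).2 p.2.2.2⟩) ⟨?_, ?_⟩)
  · intro p p' hp
    have hp := congrArg Subtype.val hp
    simp only [Prod.mk.injEq] at hp
    refine Subtype.ext (Prod.ext (funext fun i => ?_) (funext fun i => ?_))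
    · exact a.injective (congrFun hp.1 i)
    · exact b.injective (congrFun hp.2 i)
  · rintro ⟨⟨e, f⟩, he, hf, h⟩
    have he' : e = fun i => a (a.symm (e i)) := by simp
    have hf' : f = fun i => b (b.symm (f i)) := by simp
    refine ⟨⟨(fun i => a.symm (e i), fun i => b.symm (f i)),
      he.map' a.symm.toLinearMap a.symm.ker, hf.map' b.symm.toLinearMap b.symm.ker,
      (PartialIso.hasForm_act _ _ M a b I).1 ?_⟩, ?_⟩
    · simpa using h
    · exact Subtype.ext (by simp)

theorem card_formPair_push {n m : ℕ} (hnm : n ≤ m) {ι : Type*} [Fintype ι] (M : Matrix ι ι F)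
    (I : PartialIso F n) :
    Nat.card (FormPair M (I.push hnm)) = Nat.card (FormPair M I) := by
  have hinj := PartialIso.incl_injective (F := F) hnm
  symm
  refine Nat.card_congr (Equiv.ofBijective
    (fun p => ⟨(fun i => PartialIso.incl hnm (p.1.1 i), fun i => PartialIso.incl hnm (p.1.2 i)),
    p.2.1.map' _ (LinearMap.ker_eq_bot.2 hinj), p.2.2.1.map' _ (LinearMap.ker_eq_bot.2 hinj),
    (PartialIso.hasForm_push hnm _ _ M I).2 p.2.2.2⟩) ⟨?_, ?_⟩)
  · intro p p' hp
    have hp := congrArg Subtype.val hp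
    simp only [Prod.mk.injEq] at hp
    refine Subtype.ext (Prod.ext (funext fun i => ?_) (funext fun i => ?_))
    · exact hinj (congrFun hp.1 i)
    · exact hinj (congrFun hp.2 i)
  · rintro ⟨⟨e, f⟩, he, hf, h⟩
    have he1 : ∀ i, ∃ x, PartialIso.incl hnm x = e i := fun i => by
      have : e i ∈ (I.push hnm).left := by
        rw [h.1]; exact Submodule.subset_span ⟨i, rfl⟩
      obtain ⟨x, _, hx⟩ := this
      exact ⟨x, hx⟩
    have hf1 : ∀ i, ∃ x, PartialIso.incl hnm x = f i := fun i => by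
      have : f i ∈ (I.push hnm).right := by
        rw [h.2.1]; exact Submodule.subset_span ⟨i, rfl⟩
      obtain ⟨x, _, hx⟩ := this
      exact ⟨x, hx⟩
    choose e' he' using he1
    choose f' hf' using hf1
    obtain rfl : (fun i => PartialIso.incl hnm (e' i)) = e := funext he'
    obtain rfl : (fun i => PartialIso.incl hnm (f' i)) = f := funext hf'
    exact ⟨⟨(e', f'), he.of_comp (PartialIso.incl hnm), hf.of_comp (PartialIso.incl hnm),
      (PartialIso.hasForm_push hnm _ _ M I).1 h⟩, rfl⟩

theorem PartialIso.degree_push {n m : ℕ} (h : n ≤ m) (I : PartialIso F n) :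
    (I.push h).degree = I.degree :=
  ((Submodule.equivMapOfInjective _ (incl_injective h) I.left).finrank_eq).symm

theorem card_formPair_eq_zero {n : ℕ} {ι : Type*} [Fintype ι] (M : Matrix ι ι F)
    (I : PartialIso F n) (h : I.degree ≠ Fintype.card ι) : Nat.card (FormPair M I) = 0 := by
  have : IsEmpty (FormPair M I) := ⟨fun p => h (p.2.2.2.degree_eq p.2.1)⟩
  exact Nat.card_of_isEmpty

theorem coeff_transition [Fintype F] {n m : ℕ} (h : n ≤ m) (I : PartialIso F n) (x : PartIsoAlg F m) :
    PartIsoAlg.coeff I (transition h x) =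
      ((Fintype.card F : ℂ) ^ ((m - n) * I.degree) *
      (pochInv (Fintype.card F) m * pochInv (Fintype.card F) (n - I.degree)) /
      (pochInv (Fintype.card F) (m - I.degree) * pochInv (Fintype.card F) n)) *
      PartIsoAlg.coeff (I.push h) x := by
  classical
  set c : ℂ := (Fintype.card F : ℂ) ^ ((m - n) * I.degree) *
      (pochInv (Fintype.card F) m * pochInv (Fintype.card F) (n - I.degree)) /
      (pochInv (Fintype.card F) (m - I.degree) * pochInv (Fintype.card F) n) with hc
  suffices H : (PartIsoAlg.coeff I).comp (transition h) = c • PartIsoAlg.coeff (I.push h) from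
    LinearMap.congr_fun H x
  refine Finsupp.lhom_ext' fun J => LinearMap.ext_ring ?_
  change PartIsoAlg.coeff I (transition h (PartIsoAlg.of J)) =
    c * PartIsoAlg.coeff (I.push h) (PartIsoAlg.of J)
  have h1 : transition h (PartIsoAlg.of J) = ∑ I' : PartialIso F n, if I'.push h = J then
      ((Fintype.card F : ℂ) ^ ((m - n) * J.degree) *
      (pochInv (Fintype.card F) m * pochInv (Fintype.card F) (n - J.degree)) /
      (pochInv (Fintype.card F) (m - J.degree) * pochInv (Fintype.card F) n)) •
      PartIsoAlg.of I' else 0 := by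
    refine (Finsupp.linearCombination_single ℂ (1 : ℂ) J).trans ?_
    rw [one_smul]
  rw [h1, map_sum, Finset.sum_eq_single I]
  · rw [PartIsoAlg.coeff_of]
    by_cases hJ : I.push h = J
    · subst hJ
      simp [PartIsoAlg.coeff_of, PartialIso.degree_push, hc]
    · rw [if_neg hJ, if_neg fun h' => hJ h'.symm]
      simp
  · intro I' _ hI'
    split_ifs
    · rw [map_smul, PartIsoAlg.coeff_of, if_neg hI', smul_zero]
    · simp
  · simp

theorem pochInv_card_ne_zero [Fintype F] (m : ℕ) : pochInv (Fintype.card F) m ≠ 0 := by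
  refine Finset.prod_ne_zero_iff.2 fun i _ => ?_
  rw [sub_ne_zero, ne_comm, ne_eq, inv_eq_one]
  have h : 1 < Fintype.card F ^ (i + 1) := Nat.one_lt_pow (by omega) Fintype.one_lt_card
  exact_mod_cast h.ne'

theorem PartIsoAlg.ext_coeff {n : ℕ} {x y : PartIsoAlg F n}
    (h : ∀ I, PartIsoAlg.coeff I x = PartIsoAlg.coeff I y) : x = y := Finsupp.ext h

theorem normClass_mem [Fintype F] (μ : Polypartition F) :
    (fun n => normClass μ n) ∈ GenericAlg F := by
  refine ⟨fun n a b I => ?_, fun n m h => ?_, μ.size, fun n I hI => ?_⟩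
  · simp only [normClass, map_smul, coeff_classSum, card_formPair_act]
  · refine PartIsoAlg.ext_coeff fun I => ?_
    simp only [normClass]
    rw [coeff_transition, map_smul, map_smul, coeff_classSum,
      coeff_classSum, card_formPair_push, smul_eq_mul, smul_eq_mul, ← mul_assoc]
    by_cases hd : I.degree = μ.size
    · have hq : (Fintype.card F : ℂ) ≠ 0 := by exact_mod_cast Fintype.card_ne_zero
      have hp := fun k => pochInv_card_ne_zero (F := F) k
      congr 1
      rw [hd]
      have hpow : (Fintype.card F : ℂ) ^ (m * μ.size) =
          (Fintype.card F : ℂ) ^ ((m - n) * μ.size) * (Fintype.card F : ℂ) ^ (n * μ.size) := by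
        rw [← pow_add, ← add_mul, Nat.sub_add_cancel h]
      rw [hpow]
      have := hp m
      have := hp n
      have := hp (m - μ.size)
      field_simp
    · rw [card_formPair_eq_zero _ _ (by rwa [Polypartition.card_index]), Nat.cast_zero, mul_zero,
        mul_zero]
  · simp only [normClass]
    rw [map_smul, coeff_classSum, card_formPair_eq_zero _ _ (by
      rw [Polypartition.card_index]; exact hI.ne'), Nat.cast_zero, smul_zero]

/-- The generic class of a polypartition: the sequence of its normalized classes, which is an
element of the projective limit. -/
def genericClass [Fintype F] (μ : Polypartition F) : GenericAlg F := ⟨fun n => normClass μ n, normClass_mem μ⟩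

end classes

section labels

variable {F : Type*} [Field F]

/-- The label `X - a`, for `a` invertible. -/
def linLabel (a : Fˣ) : PolyLabel F :=
  ⟨X - C (a : F), monic_X_sub_C _, irreducible_X_sub_C _, fun h => by
    have := congrArg (fun P => P.coeff 0) h
    simp at this⟩

/-- The set of the `c` such that `X ^ 2 + c X + b` is irreducible. -/
def IrredSet (b : F) : Type _ := {c : F // Irreducible (X ^ 2 + C c * X + C b : F[X])}

instance [Finite F] (b : F) : Fintype (IrredSet b) :=
  have : Finite (IrredSet b) := inferInstanceAs (Finite {_c : F // _})
  Fintype.ofFinite _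

/-- The label `X ^ 2 + c X + b`, when it is irreducible. -/
def quadLabel (b : F) (c : IrredSet b) : PolyLabel F :=
  ⟨X ^ 2 + C c.1 * X + C b, by monicity!, c.2, fun h => by
    have := congrArg (fun P => P.coeff 2) h
    simp [coeff_X] at this⟩

end labels

end

/-! Up to normalization, the class of `X - a` is the sum of (e | 1 ⇌ a | f) over nonzero e, f. The
product is therefore a sum of (e | 1 ⇌ a | f) * (w | 1 ⇌ b | x) over four nonzero vectors, and it
splits according to the position of w relative to f.

If w = c f, no extension is needed and the result is the composite (e | 1 ⇌ ab | c⁻¹ x); the q - 1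
values of c produce the term with factor q - 1. If f, w are free, both factors are extended to the
plane they span. A trivial extension of the first factor is given by the preimage u of w under the
first arrow and by a parameter t locating the complement of the line of f, namely the line of w + t
f. Its second arrow has matrix [a, t(1 - a); 0, 1] (`rightExt_iff`); symmetrically the second factor
gives [1, 0; s(1 - b), b] (`leftExt_iff`). Different parameters may give the same extension, but
equally often for all extensions, so means may be taken over the parameters
(`mean_eq_of_card_fiber`). The composite has as matrix the product of these two, and the normalizing
factors, inverses of numbers of free families, make the coefficients independent of n
(`normFactor_smul_mul`): the second part of the product is q⁻² times the sum over t, s of the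
classes of these 2 × 2 matrices.

It remains to sort the matrices by conjugacy class. Put x = t(1 - a), y = s(1 - b), and let a, b
differ from 1, so that x, y run through F. The determinant is always ab and the trace is a + b + xy.
For each y ≠ 0 the matrix is not scalar, hence conjugate to a companion matrix, and each trace
occurs exactly once: this gives q - 1 copies of all companion classes of determinant ab
(`sum_matClass_shear`). The row y = 0 consists of triangular matrices with diagonal a, b: q copies
of diag(a, b) if a ≠ b; q - 1 Jordan blocks and one scalar matrix if a = b.

Finally the traces are sorted by the roots of X² - τX + ab (`sum_traces`). Split polynomials have
roots a d⁻¹ and b d; distinct roots come from two values of d, whence the factor 1/2, and a double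
root occurs when b d² = a. If a = 1 or b = 1, all the matrices are conjugate to one diagonal matrix.
-/

noncomputable section

/-! ### Matrix forms of partial isomorphisms and change of basis. -/

namespace PartialIso

variable {F : Type*} [Field F] {n : ℕ} {ι κ : Type*} [Fintype ι] [Fintype κ]

theorem HasForm.fwd_apply {e f : ι → Fin n → F} {M : Matrix ι ι F} {I : PartialIso F n}
    (h : I.HasForm e f M) (x : I.left) (c : ι → F) (hx : (x : Fin n → F) = ∑ i, c i • e i) :
    (I.fwd x : Fin n → F) = ∑ i, c i • f i := by
  have he : ∀ i, e i ∈ I.left := fun i => h.1 ▸ Submodule.subset_span ⟨i, rfl⟩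
  have : x = ∑ i, c i • (⟨e i, he i⟩ : I.left) := Subtype.ext (by simp [hx])
  rw [this]
  simp only [map_sum, map_smul, AddSubmonoidClass.coe_finsetSum, Submodule.coe_smul]
  exact Finset.sum_congr rfl fun i _ => by rw [h.2.2.1 i ⟨e i, he i⟩ rfl]

theorem HasForm.bwd_apply {e f : ι → Fin n → F} {M : Matrix ι ι F} {I : PartialIso F n}
    (h : I.HasForm e f M) (y : I.right) (c : ι → F) (hy : (y : Fin n → F) = ∑ j, c j • f j) :
    (I.bwd y : Fin n → F) = ∑ i, (∑ j, M i j * c j) • e i := by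
  have hf : ∀ i, f i ∈ I.right := fun i => h.2.1 ▸ Submodule.subset_span ⟨i, rfl⟩
  have : y = ∑ i, c i • (⟨f i, hf i⟩ : I.right) := Subtype.ext (by simp [hy])
  rw [this]
  simp only [map_sum, map_smul, AddSubmonoidClass.coe_finsetSum, Submodule.coe_smul]
  simp only [Finset.sum_smul]
  rw [Finset.sum_comm]
  refine Finset.sum_congr rfl fun i _ => ?_
  rw [h.2.2.2 i ⟨f i, hf i⟩ rfl, Finset.smul_sum]
  exact Finset.sum_congr rfl fun j _ => by rw [smul_smul, mul_comm]

/-- The arrows are determined by their values on spanning families; freeness is not needed. This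
makes every sum over the partial isomorphisms of a given form collapse to at most one term. -/
theorem HasForm.unique {e f : ι → Fin n → F} {M : Matrix ι ι F} {I J : PartialIso F n}
    (hI : I.HasForm e f M) (hJ : J.HasForm e f M) : I = J := by
  obtain ⟨L, R, g, g'⟩ := I
  obtain ⟨L', R', h, h'⟩ := J
  obtain rfl : L = L' := hI.1.trans hJ.1.symm
  obtain rfl : R = R' := hI.2.1.trans hJ.2.1.symm
  congr 1
  · refine LinearEquiv.ext fun x => Subtype.ext ?_
    obtain ⟨c, hc⟩ := (Submodule.mem_span_range_iff_exists_fun F).1 (hI.1.le x.2)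
    exact (hI.fwd_apply x c hc.symm).trans (hJ.fwd_apply x c hc.symm).symm
  · refine LinearEquiv.ext fun x => Subtype.ext ?_
    obtain ⟨c, hc⟩ := (Submodule.mem_span_range_iff_exists_fun F).1 (hI.2.1.le x.2)
    exact (hI.bwd_apply x c hc.symm).trans (hJ.bwd_apply x c hc.symm).symm

theorem exists_hasForm [DecidableEq ι] {e f : ι → Fin n → F} (he : LinearIndependent F e)
    (hf : LinearIndependent F f) {M : Matrix ι ι F} (hM : IsUnit M) :
    ∃ I : PartialIso F n, I.HasForm e f M := by
  let be := Module.Basis.span he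
  let bf := Module.Basis.span hf
  let g := bf.equiv be (Equiv.refl ι)
  let m := Matrix.toLinearEquiv be M ((Matrix.isUnit_iff_isUnit_det M).1 hM)
  refine ⟨⟨_, _, g.symm, g.trans m⟩, rfl, rfl, fun i x hx => ?_, fun j y hy => ?_⟩
  · obtain rfl : x = be i := Subtype.ext (by rw [hx, Module.Basis.span_apply])
    change ((bf.equiv be (Equiv.refl ι)).symm (be i) : Fin n → F) = _
    rw [Module.Basis.equiv_symm, Module.Basis.equiv_apply]
    exact congrArg Subtype.val (Module.Basis.span_apply hf i)
  · obtain rfl : y = bf j := Subtype.ext (by rw [hy, Module.Basis.span_apply])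
    change ((Matrix.toLin be be M) (bf.equiv be (Equiv.refl ι) (bf j)) : Fin n → F) = _
    rw [Module.Basis.equiv_apply, Equiv.refl_apply, Matrix.toLin_self]
    simp [be, Module.Basis.span_apply]

theorem HasForm.comp {e f x : ι → Fin n → F} {M N : Matrix ι ι F} {I J : PartialIso F n}
    (hI : I.HasForm e f M) (hJ : J.HasForm f x N) (h : I.right = J.left) :
    (I.comp J h).HasForm e x (M * N) := by
  refine ⟨hI.1, hJ.2.1, fun i z hz => ?_, fun j z hz => ?_⟩
  · exact hJ.2.2.1 i _ (hI.2.2.1 i z hz)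
  · have := hI.bwd_apply (LinearEquiv.ofEq _ _ h.symm (J.bwd z)) (fun i => N i j)
      (hJ.2.2.2 j z hz)
    simp only [Matrix.mul_apply]
    exact this

/-- The first arrow identifies e with f, so both families must be changed by the same matrix h; the
second arrow then behaves like an endomorphism, and its matrix changes by conjugation. -/
theorem HasForm.change {e f : ι → Fin n → F} {e' f' : κ → Fin n → F} {M : Matrix ι ι F}
    {N : Matrix κ κ F} {I : PartialIso F n} (hI : I.HasForm e f M) (h : Matrix ι κ F)
    (hM : M * h = h * N)
    (he : Submodule.span F (Set.range e') = Submodule.span F (Set.range e))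
    (hf : Submodule.span F (Set.range f') = Submodule.span F (Set.range f))
    (he' : ∀ j, e' j = ∑ i, h i j • e i) (hf' : ∀ j, f' j = ∑ i, h i j • f i) :
    I.HasForm e' f' N := by
  refine ⟨hI.1.trans he.symm, hI.2.1.trans hf.symm, fun j x hx => ?_, fun j y hy => ?_⟩
  · rw [hf' j]
    exact hI.fwd_apply x _ (hx.trans (he' j))
  · rw [hI.bwd_apply y _ (hy.trans (hf' j))]
    simp only [he', Finset.smul_sum, smul_smul]
    rw [Finset.sum_comm]
    simp only [← Finset.sum_smul]
    refine Finset.sum_congr rfl fun i _ => ?_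
    congr 1
    have := congrFun (congrFun hM i) j
    simp only [Matrix.mul_apply] at this
    rw [this]
    exact Finset.sum_congr rfl fun _ _ => mul_comm _ _

theorem HasForm.of_columns {e f : ι → Fin n → F} {M N h : Matrix ι ι F} {I : PartialIso F n}
    [DecidableEq ι]
    (hI : I.HasForm e f M) (hh : IsUnit h) (hM : M * h = h * N) :
    I.HasForm (fun j => ∑ i, h i j • e i) (fun j => ∑ i, h i j • f i) N := by
  have key : ∀ e : ι → Fin n → F, Submodule.span F (Set.range fun j => ∑ i, h i j • e i) =
      Submodule.span F (Set.range e) := fun e => by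
    apply le_antisymm <;> rw [Submodule.span_le] <;> rintro _ ⟨j, rfl⟩
    · exact Submodule.sum_mem _ fun i _ =>
        Submodule.smul_mem _ _ (Submodule.subset_span ⟨i, rfl⟩)
    · have : e j = ∑ k, (h⁻¹) k j • ∑ i, h i k • e i := by
        simp only [Finset.smul_sum, smul_smul]
        rw [Finset.sum_comm]
        simp only [← Finset.sum_smul]
        have h1 : ∀ i, ∑ k, h⁻¹ k j * h i k = (1 : Matrix ι ι F) i j := fun i => by
          rw [← Matrix.mul_nonsing_inv h ((Matrix.isUnit_iff_isUnit_det h).1 hh), Matrix.mul_apply]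
          exact Finset.sum_congr rfl fun _ _ => mul_comm _ _
        simp [h1, Matrix.one_apply]
      rw [SetLike.mem_coe, this]
      exact Submodule.sum_mem _ fun i _ =>
        Submodule.smul_mem _ _ (Submodule.subset_span ⟨i, rfl⟩)
  exact hI.change h hM (key e) (key f) (fun _ => rfl) fun _ => rfl

theorem linearIndependent_columns [DecidableEq ι] {h : Matrix ι ι F} (hh : IsUnit h)
    {e : ι → Fin n → F} (he : LinearIndependent F e) :
    LinearIndependent F fun j => ∑ i, h i j • e i := by
  have h1 : LinearIndependent F h.col := Matrix.linearIndependent_cols_iff_isUnit.2 hh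
  have h2 := h1.map' (Fintype.linearCombination F e)
    (LinearMap.ker_eq_bot.2 (he.fintypeLinearCombination_injective))
  exact h2

theorem hasForm_reindex_iff (σ : ι ≃ κ) (M : Matrix ι ι F) (N : Matrix κ κ F)
    (h : ∀ i j, M i j = N (σ i) (σ j)) (e f : κ → Fin n → F) (I : PartialIso F n) :
    I.HasForm (fun i => e (σ i)) (fun i => f (σ i)) M ↔ I.HasForm e f N := by
  have hr : ∀ e : κ → Fin n → F, Set.range (fun i => e (σ i)) = Set.range e :=
    fun e => σ.surjective.range_comp e
  unfold HasForm
  rw [hr, hr]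
  refine and_congr Iff.rfl (and_congr Iff.rfl (and_congr ?_ ?_))
  · exact σ.forall_congr_left.trans (by simp)
  · refine σ.forall_congr_left.trans ?_
    simp only [h, Equiv.apply_symm_apply]
    refine forall_congr' fun j => forall_congr' fun y => ?_
    rw [σ.sum_comp (fun i => N i j • e i)]

end PartialIso

/-! ### Sums over free families, as invariants of conjugacy classes of matrices. -/

section formEl

variable {F : Type*} [Field F] [Fintype F] {n : ℕ} {ι κ : Type*} [Fintype ι] [Fintype κ]

open Classical in
/-- The basis element `(Span e | 1 ⇌ M | Span f)`, or zero if there is no such partial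
isomorphism. -/
def formEl (e f : ι → Fin n → F) (M : Matrix ι ι F) : PartIsoAlg F n :=
  ∑ I : PartialIso F n, if I.HasForm e f M then PartIsoAlg.of I else 0

open Classical in
theorem PartialIso.HasForm.sum_ite {A : Type*} [AddCommMonoid A] {e f : ι → Fin n → F}
    {M : Matrix ι ι F} {I : PartialIso F n} (h : I.HasForm e f M) (g : PartialIso F n → A) :
    (∑ J : PartialIso F n, if J.HasForm e f M then g J else 0) = g I := by
  rw [Finset.sum_eq_single I]
  · rw [if_pos h]
  · intro J _ hJ
    rw [if_neg fun h' => hJ (h'.unique h)]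
  · simp

theorem formEl_eq_of {e f : ι → Fin n → F} {M : Matrix ι ι F} {I : PartialIso F n}
    (h : I.HasForm e f M) : formEl e f M = PartIsoAlg.of I := h.sum_ite _

theorem formEl_congr {e f : ι → Fin n → F} {M : Matrix ι ι F} {e' f' : κ → Fin n → F}
    {N : Matrix κ κ F} (h : ∀ I : PartialIso F n, I.HasForm e f M ↔ I.HasForm e' f' N) :
    formEl e f M = formEl e' f' N := by
  classical
  exact Finset.sum_congr rfl fun I _ => by simp only [h I]

/-- The sum of the partial isomorphisms `(Span e | 1 ⇌ M | Span f)` over all free families `e` and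
`f`. -/
def formSum (M : Matrix ι ι F) (n : ℕ) : PartIsoAlg F n :=
  ∑ e : FreeFamily F n ι, ∑ f : FreeFamily F n ι, formEl e.1 f.1 M

theorem formSum_reindex (σ : ι ≃ κ) (M : Matrix ι ι F) (N : Matrix κ κ F)
    (h : ∀ i j, M i j = N (σ i) (σ j)) (n : ℕ) : formSum M n = formSum N n := by
  let E : FreeFamily F n κ ≃ FreeFamily F n ι :=
    (σ.symm.arrowCongr (Equiv.refl _)).subtypeEquiv fun e => by
      change _ ↔ LinearIndependent F (e ∘ σ)
      rw [linearIndependent_equiv]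
  unfold formSum
  rw [← E.sum_comp]
  refine Finset.sum_congr rfl fun e _ => ?_
  rw [← E.sum_comp]
  refine Finset.sum_congr rfl fun f _ => ?_
  exact formEl_congr fun I => PartialIso.hasForm_reindex_iff σ M N h e.1 f.1 I

/-- The substitution of e h for e and of f h for f permutes the free families and conjugates the
matrix by h. -/
theorem formSum_eq_of_conj [DecidableEq ι] (h M N : Matrix ι ι F) (hh : IsUnit h)
    (hM : M * h = h * N) (n : ℕ) : formSum M n = formSum N n := by
  have hd := (Matrix.isUnit_iff_isUnit_det h).1 hh
  have hh' : IsUnit h⁻¹ := (Matrix.isUnit_nonsing_inv_iff).2 hh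
  have hM' : N * h⁻¹ = h⁻¹ * M := by
    calc N * h⁻¹ = h⁻¹ * (h * N) * h⁻¹ := by
          rw [← Matrix.mul_assoc, Matrix.nonsing_inv_mul h hd, Matrix.one_mul]
      _ = h⁻¹ * M := by
          rw [← hM, Matrix.mul_assoc, Matrix.mul_assoc, Matrix.mul_nonsing_inv h hd, Matrix.mul_one]
  have inv : ∀ (h k : Matrix ι ι F) (_ : h * k = 1) (e : ι → Fin n → F),
      (fun j => ∑ i, k i j • ∑ l, h l i • e l) = e := fun h k hk e => by
    funext j
    simp only [Finset.smul_sum, smul_smul]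
    rw [Finset.sum_comm]
    simp only [← Finset.sum_smul]
    have h1 : ∀ l, ∑ i, k i j * h l i = (1 : Matrix ι ι F) l j := fun l => by
      rw [← hk, Matrix.mul_apply]
      exact Finset.sum_congr rfl fun _ _ => mul_comm _ _
    simp [h1, Matrix.one_apply]
  let E : FreeFamily F n ι ≃ FreeFamily F n ι :=
    { toFun := fun e => ⟨_, PartialIso.linearIndependent_columns hh e.2⟩
      invFun := fun e => ⟨_, PartialIso.linearIndependent_columns hh' e.2⟩
      left_inv := fun e => Subtype.ext (inv _ _ (Matrix.mul_nonsing_inv h hd) e.1)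
      right_inv := fun e => Subtype.ext (inv _ _ (Matrix.nonsing_inv_mul h hd) e.1) }
  symm
  unfold formSum
  rw [← E.sum_comp]
  refine Finset.sum_congr rfl fun e _ => ?_
  rw [← E.sum_comp]
  refine Finset.sum_congr rfl fun f _ => ?_
  refine formEl_congr fun I => ⟨fun H => ?_, fun H => H.of_columns hh hM⟩
  have := H.of_columns hh' hM'
  have h1 := inv _ _ (Matrix.mul_nonsing_inv h hd) e.1
  have h2 := inv _ _ (Matrix.mul_nonsing_inv h hd) f.1
  simp only [E, Equiv.coe_fn_mk] at this
  rwa [h1, h2] at this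

end formEl

/-! ### Trivial extensions of partial isomorphisms of degree one, and means over them. -/

-- Double counting: if `r` is the graph of a map from `X` onto the elements satisfying `R`, with all
-- fibres of the same size `k`, then the mean over the target is the mean over the parameters in
-- `X`.
open Classical in
theorem mean_eq_of_card_fiber {α β A : Type*} [Fintype β] [AddCommGroup A] [Module ℂ A]
    (X : Finset α) (R : β → Prop) {_ : Fintype {b // R b}} (r : α → β → Prop) (k : ℕ) (hk : k ≠ 0)
    (h1 : ∀ x ∈ X, ∃! b, r x b) (h2 : ∀ x ∈ X, ∀ b, r x b → R b)
    (h3 : ∀ b, R b → (X.filter fun x => r x b).card = k) (g : β → A) :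
    (Fintype.card {b // R b} : ℂ)⁻¹ • ∑ b : {b // R b}, g b =
      (X.card : ℂ)⁻¹ • ∑ x ∈ X, ∑ b : β, if r x b then g b else 0 := by
  have key : ∀ b, (∑ x ∈ X, if r x b then g b else 0) = if R b then (k : ℂ) • g b else 0 := by
    intro b
    rw [← Finset.sum_filter, Finset.sum_const]
    split_ifs with hb
    · rw [h3 b hb, Nat.cast_smul_eq_nsmul]
    · rw [Finset.filter_false_of_mem fun x hx hr => hb (h2 x hx b hr), Finset.card_empty, zero_smul]
  have hcard : X.card = k * Fintype.card {b // R b} := by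
    have := Finset.sum_card_bipartiteAbove_eq_sum_card_bipartiteBelow (s := X)
      (t := Finset.univ.filter R) r
    have hb : ∑ b with R b, (Finset.bipartiteBelow r X b).card = ∑ b with R b, k :=
      Finset.sum_congr rfl fun b hb => h3 b (Finset.mem_filter.1 hb).2
    rw [hb, Finset.sum_congr rfl (g := fun _ => 1) fun x hx => ?_] at this
    · rw [Finset.sum_const, Finset.sum_const, smul_eq_mul, smul_eq_mul, mul_one, mul_comm] at this
      rw [this, Fintype.card_subtype]
    · obtain ⟨b, hb, hb'⟩ := h1 x hx
      refine Finset.card_eq_one.2 ⟨b, ?_⟩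
      ext c
      simp only [Finset.bipartiteAbove, Finset.mem_filter, Finset.mem_univ, true_and,
        Finset.mem_singleton]
      exact ⟨fun h => hb' c h.2, fun h => h ▸ ⟨h2 x hx b hb, hb⟩⟩
  have hk' : (k : ℂ) ≠ 0 := by exact_mod_cast hk
  rw [Finset.sum_comm, Finset.sum_congr rfl fun b _ => key b, ← Finset.sum_filter,
    ← Finset.smul_sum, smul_smul, hcard, Nat.cast_mul, mul_inv, mul_right_comm,
    inv_mul_cancel₀ hk', one_mul]
  congr 1
  exact (Finset.sum_subtype _ (by simp) g).symm

namespace PartialIso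

variable {F : Type*} [Field F] {n : ℕ}

theorem span_range_pair (e u : Fin n → F) :
    Submodule.span F (Set.range ![e, u]) = Submodule.span F {e, u} := by
  simp [Matrix.range_cons, Matrix.range_empty, Set.pair_comm]

theorem span_range_single (e : Fin n → F) :
    Submodule.span F (Set.range ![e]) = Submodule.span F {e} := by
  simp [Matrix.range_cons, Matrix.range_empty]

theorem isTrivialExtension_of_hasForm_diag {e u f w : Fin n → F} {a : F} {I P : PartialIso F n}
    (hI : I.HasForm ![e] ![f] !![a]) (heu : LinearIndependent F ![e, u])
    (hfw : LinearIndependent F ![f, w]) (hP : P.HasForm ![e, u] ![f, w] !![a, 0; 0, 1]) :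
    IsTrivialExtension I P := by
  have hdis : ∀ {e u : Fin n → F}, LinearIndependent F ![e, u] →
      Disjoint (Submodule.span F {e}) (Submodule.span F {u}) := by
    intro e u h
    rw [Submodule.disjoint_def]
    intro x hx hx'
    obtain ⟨c, rfl⟩ := Submodule.mem_span_singleton.1 hx
    obtain ⟨d, hd⟩ := Submodule.mem_span_singleton.1 hx'
    have := (LinearIndependent.pair_iff.1 h c (-d) (by rw [neg_smul, hd, add_neg_cancel])).1
    rw [this, zero_smul]
  have hIl : I.left = Submodule.span F {e} := by rw [hI.1, span_range_single]
  have hIr : I.right = Submodule.span F {f} := by rw [hI.2.1, span_range_single]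
  have hPl : P.left = Submodule.span F {e, u} := by rw [hP.1, span_range_pair]
  have hPr : P.right = Submodule.span F {f, w} := by rw [hP.2.1, span_range_pair]
  have hfu : ∀ (x : P.left) (c : F), (x : Fin n → F) = c • u → (P.fwd x : Fin n → F) = c • w :=
    fun x c hx => by simpa using hP.fwd_apply x ![0, c] (by simp [hx])
  have hbw : ∀ (x : P.right) (c : F), (x : Fin n → F) = c • w → (P.bwd x : Fin n → F) = c • u :=
    fun x c hx => by simpa using hP.bwd_apply x ![0, c] (by simp [hx])
  refine ⟨⟨?_, ?_, ?_, ?_⟩, Submodule.span F {u}, Submodule.span F {w}, ?_, ?_, ?_, ?_, ?_, ?_⟩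
  · rw [hIl, hPl]; exact Submodule.span_mono (by simp)
  · rw [hIr, hPr]; exact Submodule.span_mono (by simp)
  · intro x y hxy
    obtain ⟨c, hc⟩ := Submodule.mem_span_singleton.1 (hIl.le x.2)
    have h1 := hI.fwd_apply x ![c] (by simp [hc])
    have h2 := hP.fwd_apply y ![c, 0] (by simp [hc, hxy])
    rw [h1, h2]; simp
  · intro x y hxy
    obtain ⟨c, hc⟩ := Submodule.mem_span_singleton.1 (hIr.le x.2)
    have h1 := hI.bwd_apply x ![c] (by simp [hc])
    have h2 := hP.bwd_apply y ![c, 0] (by simp [hc, hxy])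
    rw [h1, h2]; simp
  · rw [hIl]; exact hdis heu
  · rw [hIl, hPl, Submodule.span_insert]
  · rw [hIr]; exact hdis hfw
  · rw [hIr, hPr, Submodule.span_insert]
  · intro x hx
    obtain ⟨c, hc⟩ := Submodule.mem_span_singleton.1 hx
    have h1 := hfu x c hc.symm
    refine ⟨h1 ▸ Submodule.smul_mem _ _ (Submodule.mem_span_singleton_self w), Subtype.ext ?_⟩
    rw [hbw _ c h1, hc]
  · intro x hx
    obtain ⟨c, hc⟩ := Submodule.mem_span_singleton.1 hx
    have h1 := hbw x c hc.symm
    refine ⟨h1 ▸ Submodule.smul_mem _ _ (Submodule.mem_span_singleton_self u), Subtype.ext ?_⟩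
    rw [hfu _ c h1, hc]

theorem linearIndependent_pair_add_smul {e u : Fin n → F} (h : LinearIndependent F ![e, u]) (t : F) :
    LinearIndependent F ![e, u + t • e] := by
  rw [LinearIndependent.pair_iff] at h ⊢
  intro c d hcd
  have := h (c + d * t) d (by rw [← hcd]; module)
  obtain ⟨h1, rfl⟩ := this
  simpa using h1

theorem linearIndependent_pair_swap {e u : Fin n → F} (h : LinearIndependent F ![e, u]) :
    LinearIndependent F ![u, e] := by
  rw [LinearIndependent.pair_iff] at h ⊢
  intro c d hcd
  exact (h d c (by rw [← hcd, add_comm])).symm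

theorem HasForm.swap {e u f w : Fin n → F} {a b c d : F} {P : PartialIso F n}
    (hP : P.HasForm ![e, u] ![f, w] !![a, b; c, d]) :
    P.HasForm ![u, e] ![w, f] !![d, c; b, a] := by
  have := (hasForm_reindex_iff (Equiv.swap (0 : Fin 2) 1) !![d, c; b, a] !![a, b; c, d]
    (by intro i j; fin_cases i <;> fin_cases j <;> simp) ![e, u] ![f, w] P).2 hP
  convert this using 1 <;> (funext i; fin_cases i <;> simp)

/-- Conjugation by the unipotent matrix [1, t; 0, 1]. For x = t(d - a) it makes the matrix diagonal,
which exhibits the complements of a trivial extension. -/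
theorem HasForm.shear {e u f w : Fin n → F} {a x d : F} {P : PartialIso F n}
    (hP : P.HasForm ![e, u] ![f, w] !![a, x; 0, d]) (t : F) :
    P.HasForm ![e, u + t • e] ![f, w + t • f] !![a, x + t * (a - d); 0, d] := by
  have hu : IsUnit !![1, t; 0, (1 : F)] := by
    rw [Matrix.isUnit_iff_isUnit_det]; simp
  have := hP.of_columns (h := !![1, t; 0, 1]) (N := !![a, x + t * (a - d); 0, d]) hu (by
    ext i j; fin_cases i <;> fin_cases j <;> simp [Matrix.mul_apply, Fin.sum_univ_two]
    ring)
  convert this using 1 <;> (funext i; fin_cases i <;> simp [Fin.sum_univ_two, add_comm])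

theorem linearIndependent_of_fwd {e u f w : Fin n → F} (P : PartialIso F n)
    (x y : P.left) (hx : (x : Fin n → F) = e) (hy : (y : Fin n → F) = u)
    (hx' : (P.fwd x : Fin n → F) = f) (hy' : (P.fwd y : Fin n → F) = w) :
    LinearIndependent F ![e, u] ↔ LinearIndependent F ![f, w] := by
  subst hx hy hx' hy'
  rw [LinearIndependent.pair_iff, LinearIndependent.pair_iff]
  refine forall_congr' fun s => forall_congr' fun t => ?_
  refine imp_congr_left ?_
  have h1 : s • (x : Fin n → F) + t • (y : Fin n → F) = ((s • x + t • y : P.left) : Fin n → F) := rfl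
  have h2 : s • (P.fwd x : Fin n → F) + t • (P.fwd y : Fin n → F) =
    (P.fwd (s • x + t • y) : Fin n → F) := by simp
  rw [h1, h2, ZeroMemClass.coe_eq_zero, ZeroMemClass.coe_eq_zero, LinearEquiv.map_eq_zero_iff]

/-- One of the two spans is enough, since the first arrow carries one pair of vectors to the other.
-/
theorem hasForm_pair_of_values {e u f w : Fin n → F} {a b c d : F} (P : PartialIso F n)
    (x y : P.left) (hx : (x : Fin n → F) = e) (hy : (y : Fin n → F) = u)
    (hx' : (P.fwd x : Fin n → F) = f) (hy' : (P.fwd y : Fin n → F) = w)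
    (h : P.right = Submodule.span F {f, w} ∨ P.left = Submodule.span F {e, u})
    (hf : (P.bwd (P.fwd x) : Fin n → F) = a • e + c • u)
    (hw : (P.bwd (P.fwd y) : Fin n → F) = b • e + d • u) :
    P.HasForm ![e, u] ![f, w] !![a, b; c, d] := by
  subst hx hy hx' hy'
  have hmem : ∀ (V : Submodule F (Fin n → F)) (x y : V),
      V = Submodule.span F {(x : Fin n → F), (y : Fin n → F)} ↔
      ∀ z : V, ∃ s t : F, s • x + t • y = z := by
    intro V x y
    constructor
    · intro h z
      obtain ⟨s, t, hst⟩ := Submodule.mem_span_pair.1 (h.le z.2)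
      exact ⟨s, t, Subtype.ext hst⟩
    · intro h
      apply le_antisymm
      · intro z hz
        obtain ⟨s, t, hst⟩ := h ⟨z, hz⟩
        exact Submodule.mem_span_pair.2 ⟨s, t, congrArg Subtype.val hst⟩
      · rw [Submodule.span_le]
        rintro _ (rfl | rfl)
        exacts [x.2, y.2]
  have hlr : P.right = Submodule.span F {(P.fwd x : Fin n → F), (P.fwd y : Fin n → F)} ↔
      P.left = Submodule.span F {(x : Fin n → F), (y : Fin n → F)} := by
    rw [hmem, hmem]
    constructor
    · intro h z
      obtain ⟨s, t, hst⟩ := h (P.fwd z)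
      exact ⟨s, t, P.fwd.injective (by simpa using hst)⟩
    · intro h z
      obtain ⟨s, t, hst⟩ := h (P.fwd.symm z)
      exact ⟨s, t, P.fwd.symm.injective (by simpa using hst)⟩
  have h' := h.elim (fun h => And.intro h (hlr.1 h)) fun h => And.intro (hlr.2 h) h
  refine ⟨by rw [span_range_pair, ← h'.2], by rw [span_range_pair, ← h'.1], ?_, ?_⟩
  · intro i z hz
    fin_cases i
    · obtain rfl : z = x := Subtype.ext hz
      rfl
    · obtain rfl : z = y := Subtype.ext hz
      rfl
  · intro i z hz
    fin_cases i
    · obtain rfl : z = P.fwd x := Subtype.ext hz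
      simpa [Fin.sum_univ_two] using hf
    · obtain rfl : z = P.fwd y := Subtype.ext hz
      simpa [Fin.sum_univ_two] using hw

/-- With u the preimage of w under the first arrow, the complements are the lines of w + t f and u +
t e. The second arrow sends w + t f to u + t e and f to a e, hence w to u + t(1 - a) e. -/
theorem rightExt_iff {e f w : Fin n → F} {a : F} {I : PartialIso F n}
    (hI : I.HasForm ![e] ![f] !![a]) (hfw : LinearIndependent F ![f, w]) (P : PartialIso F n) :
    (IsTrivialExtension I P ∧ P.right = Submodule.span F {f, w}) ↔
      ∃ t u, LinearIndependent F ![e, u] ∧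
        P.HasForm ![e, u] ![f, w] !![a, t * (1 - a); 0, 1] := by
  have hIl : I.left = Submodule.span F {e} := by rw [hI.1, span_range_single]
  have hIr : I.right = Submodule.span F {f} := by rw [hI.2.1, span_range_single]
  constructor
  · rintro ⟨⟨⟨hle, hre, hfe, hbe⟩, A, B, -, -, -, hB, hA', hB'⟩, hr⟩
    let x' : I.left := ⟨e, by rw [hIl]; exact Submodule.mem_span_singleton_self e⟩
    let x : P.left := ⟨e, hle x'.2⟩
    let z' : I.right := ⟨f, by rw [hIr]; exact Submodule.mem_span_singleton_self f⟩
    let z : P.right := ⟨f, hre z'.2⟩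
    let v : P.right := ⟨w, by rw [hr]; exact Submodule.subset_span (by simp)⟩
    let y := P.fwd.symm v
    have hx : (P.fwd x : Fin n → F) = f := by
      rw [← hfe x' x rfl, hI.fwd_apply x' ![1] (by simp [x'])]; simp
    have hxz : P.fwd x = z := Subtype.ext hx
    have hy : P.fwd y = v := P.fwd.apply_symm_apply v
    have hz : (P.bwd z : Fin n → F) = a • e := by
      rw [← hbe z' z rfl, hI.bwd_apply z' ![1] (by simp [z'])]; simp
    -- Decompose w = β f + b with b in the complement B. On B the two arrows are mutually inverse,
    -- so the second one sends b to u - β e; hence the parameter is t = -β.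
    obtain ⟨p, hp, b, hb, hpb⟩ := Submodule.mem_sup.1 (hB.ge v.2)
    obtain ⟨β, rfl⟩ := Submodule.mem_span_singleton.1 (hIr.le hp)
    let b' : P.right := ⟨b, hB.le (Submodule.mem_sup_right hb)⟩
    have hv : v = β • z + b' := Subtype.ext hpb.symm
    have hb1 : P.bwd b' = y - β • x := P.fwd.injective (by
      rw [(hB' b' hb).2, map_sub, map_smul, hy, hxz, hv]; simp)
    have hv' : P.bwd v = β • P.bwd z + (y - β • x) := by
      conv_lhs => rw [hv]
      rw [map_add, map_smul, hb1]
    refine ⟨-β, y, (linearIndependent_of_fwd P x y rfl rfl hx (congrArg _ hy)).2 hfw,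
      hasForm_pair_of_values P x y rfl rfl hx (congrArg _ hy) (Or.inl hr) ?_ ?_⟩
    · rw [hxz, hz, zero_smul, add_zero]
    · rw [hy, hv']
      simp only [Submodule.coe_add, Submodule.coe_smul, Submodule.coe_sub, hz]
      change β • a • e + ((y : Fin n → F) - β • e) = _
      module
  · rintro ⟨t, u, heu, hP⟩
    refine ⟨?_, by rw [hP.2.1, span_range_pair]⟩
    -- In the bases (e, u + t e) and (f, w + t f) the matrix becomes diag(a, 1).
    have := hP.shear t
    rw [show t * (1 - a) + t * (a - 1) = 0 by ring] at this
    exact isTrivialExtension_of_hasForm_diag hI (linearIndependent_pair_add_smul heu t)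
      (linearIndependent_pair_add_smul hfw t) this

/-- Mirror image of `rightExt_iff`: now the line of w is given, and f + s w spans the complement in
the plane. -/
theorem leftExt_iff {f w x : Fin n → F} {b : F} {J : PartialIso F n}
    (hJ : J.HasForm ![w] ![x] !![b]) (hfw : LinearIndependent F ![f, w]) (Q : PartialIso F n) :
    (IsTrivialExtension J Q ∧ Q.left = Submodule.span F {f, w}) ↔
      ∃ s y, LinearIndependent F ![y, x] ∧
        Q.HasForm ![f, w] ![y, x] !![1, 0; s * (1 - b), b] := by
  have hJl : J.left = Submodule.span F {w} := by rw [hJ.1, span_range_single]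
  have hJr : J.right = Submodule.span F {x} := by rw [hJ.2.1, span_range_single]
  constructor
  · rintro ⟨⟨⟨hle, hre, hfe, hbe⟩, A, B, -, hA, -, -, hA', hB'⟩, hl⟩
    let w' : J.left := ⟨w, by rw [hJl]; exact Submodule.mem_span_singleton_self w⟩
    let wQ : Q.left := ⟨w, hle w'.2⟩
    let x' : J.right := ⟨x, by rw [hJr]; exact Submodule.mem_span_singleton_self x⟩
    let xQ : Q.right := ⟨x, hre x'.2⟩
    let fQ : Q.left := ⟨f, by rw [hl]; exact Submodule.subset_span (by simp)⟩
    have hw : (Q.fwd wQ : Fin n → F) = x := by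
      rw [← hfe w' wQ rfl, hJ.fwd_apply w' ![1] (by simp [w'])]; simp
    have hwx : Q.fwd wQ = xQ := Subtype.ext hw
    have hx : (Q.bwd xQ : Fin n → F) = b • w := by
      rw [← hbe x' xQ rfl, hJ.bwd_apply x' ![1] (by simp [x'])]; simp
    obtain ⟨p, hp, c, hc, hpc⟩ := Submodule.mem_sup.1 (hA.ge fQ.2)
    obtain ⟨γ, rfl⟩ := Submodule.mem_span_singleton.1 (hJl.le hp)
    let c' : Q.left := ⟨c, hA.le (Submodule.mem_sup_right hc)⟩
    have hf : fQ = γ • wQ + c' := Subtype.ext hpc.symm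
    have hf' : Q.bwd (Q.fwd fQ) = γ • Q.bwd xQ + (fQ - γ • wQ) := by
      conv_lhs => rw [hf]
      rw [map_add, map_add, map_smul, map_smul, hwx, (hA' c' hc).2, hf, add_sub_cancel_left]
    refine ⟨-γ, Q.fwd fQ, (linearIndependent_of_fwd Q fQ wQ rfl rfl rfl hw).1 hfw,
      hasForm_pair_of_values Q fQ wQ rfl rfl rfl hw (Or.inr hl) ?_ ?_⟩
    · rw [hf']
      simp only [Submodule.coe_add, Submodule.coe_smul, Submodule.coe_sub, hx]
      change γ • b • w + (f - γ • w) = _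
      module
    · rw [hwx, hx, zero_smul, zero_add]
  · rintro ⟨s, y, hyx, hQ⟩
    refine ⟨?_, by rw [hQ.1, span_range_pair]⟩
    have := hQ.swap.shear s
    rw [show s * (1 - b) + s * (b - 1) = 0 by ring] at this
    exact isTrivialExtension_of_hasForm_diag hJ
      (linearIndependent_pair_add_smul (linearIndependent_pair_swap hfw) s)
      (linearIndependent_pair_add_smul (linearIndependent_pair_swap hyx) s) this

open Classical in
theorem card_filter_mul_eq [Fintype F] (a t₀ : F) :
    (Finset.univ.filter fun t : F => t * a = t₀ * a).card =
      (Finset.univ.filter fun t : F => t * a = 0).card :=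
  Finset.card_nbij' (fun t => t - t₀) (fun t => t + t₀)
    (fun t ht => by
      have : t * a = t₀ * a := by simpa using ht
      simpa [sub_mul, sub_eq_zero] using this)
    (fun t ht => by
      have : t * a = 0 := by simpa using ht
      simpa using this)
    (fun t _ => by simp) (fun t _ => by simp)

open Classical in
/-- The pairs `(t, u)`, where the family `(e, u)` is free. -/
def shearPairs [Fintype F] (e : Fin n → F) : Finset (F × (Fin n → F)) :=
  Finset.univ.filter fun p => LinearIndependent F ![e, p.2]

/-- The vector u is the preimage of w under the first arrow, and the entries of the second column
are coordinates in a free family. So an extension determines u and t(1 - a), though not always t. -/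
theorem HasForm.eq_of_pair {e u u' f w : Fin n → F} {a b c d a' b' c' d' : F} {P : PartialIso F n}
    (heu : LinearIndependent F ![e, u])
    (h : P.HasForm ![e, u] ![f, w] !![a, b; c, d])
    (h' : P.HasForm ![e, u'] ![f, w] !![a', b'; c', d']) : u' = u ∧ b' = b := by
  have hu : u ∈ P.left := by rw [h.1, span_range_pair]; exact Submodule.subset_span (by simp)
  have hu' : u' ∈ P.left := by rw [h'.1, span_range_pair]; exact Submodule.subset_span (by simp)
  have hw : w ∈ P.right := by rw [h.2.1, span_range_pair]; exact Submodule.subset_span (by simp)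
  have h1 := h.2.2.1 1 ⟨u, hu⟩ rfl
  have h2 := h'.2.2.1 1 ⟨u', hu'⟩ rfl
  have h3 : (⟨u', hu'⟩ : P.left) = ⟨u, hu⟩ :=
    P.fwd.injective (Subtype.ext (h2.trans h1.symm))
  have h3 : u' = u := congrArg Subtype.val h3
  subst h3
  have h4 := (h'.2.2.2 1 ⟨w, hw⟩ rfl).symm.trans (h.2.2.2 1 ⟨w, hw⟩ rfl)
  simp only [Fin.sum_univ_two, Matrix.of_apply, Matrix.cons_val_zero, Matrix.cons_val_one,
    Matrix.cons_val'] at h4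
  refine ⟨rfl, ?_⟩
  have := (LinearIndependent.pair_iff.1 heu (b' - b) (d' - d) (by
    rw [sub_smul, sub_smul, ← add_sub_add_comm, sub_eq_zero]; exact h4)).1
  exact sub_eq_zero.1 this

theorem HasForm.eq_of_pair_right {f w x y y' : Fin n → F} {a b c d a' b' c' d' : F}
    {P : PartialIso F n} (hfw : LinearIndependent F ![f, w])
    (h : P.HasForm ![f, w] ![y, x] !![a, b; c, d])
    (h' : P.HasForm ![f, w] ![y', x] !![a', b'; c', d']) : y' = y ∧ c' = c := by
  have hf : f ∈ P.left := by rw [h.1, span_range_pair]; exact Submodule.subset_span (by simp)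
  have hy : y' = y := (h'.2.2.1 0 ⟨f, hf⟩ rfl).symm.trans (h.2.2.1 0 ⟨f, hf⟩ rfl)
  subst hy
  have hy : y' ∈ P.right := by rw [h.2.1, span_range_pair]; exact Submodule.subset_span (by simp)
  have h4 := (h'.2.2.2 0 ⟨y', hy⟩ rfl).symm.trans (h.2.2.2 0 ⟨y', hy⟩ rfl)
  simp only [Fin.sum_univ_two, Matrix.of_apply, Matrix.cons_val_zero, Matrix.cons_val_one,
    Matrix.cons_val'] at h4
  refine ⟨rfl, ?_⟩
  have := (LinearIndependent.pair_iff.1 hfw (a' - a) (c' - c) (by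
    rw [sub_smul, sub_smul, ← add_sub_add_comm, sub_eq_zero]; exact h4)).2
  exact sub_eq_zero.1 this

variable [Fintype F] {A : Type*} [AddCommGroup A] [Module ℂ A]

open Classical in
theorem rightExt_mean {e f w : Fin n → F} {a : F} (ha : a ≠ 0) {I : PartialIso F n}
    (hI : I.HasForm ![e] ![f] !![a]) (hfw : LinearIndependent F ![f, w]) (g : PartialIso F n → A) :
    (Fintype.card (I.RightExt (Submodule.span F {f, w})) : ℂ)⁻¹ •
      ∑ P : I.RightExt (Submodule.span F {f, w}), g P.1 =
    ((shearPairs e).card : ℂ)⁻¹ • ∑ p ∈ shearPairs e, ∑ P : PartialIso F n,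
      if P.HasForm ![e, p.2] ![f, w] !![a, p.1 * (1 - a); 0, 1] then g P else 0 := by
  refine mean_eq_of_card_fiber (shearPairs e)
    (fun P => IsTrivialExtension I P ∧ P.right = Submodule.span F {f, w})
    (fun p P => P.HasForm ![e, p.2] ![f, w] !![a, p.1 * (1 - a); 0, 1])
    -- The common size of the fibres: 1 if a ≠ 1, and q if a = 1, when the parameter t has no
    -- effect. Counting the kernel treats both cases together.
    (Finset.univ.filter fun t : F => t * (1 - a) = 0).card ?_ ?_ ?_ ?_ g
  · exact (Finset.card_pos.2 ⟨0, by simp⟩).ne'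
  · intro p hp
    obtain ⟨P, hP⟩ := exists_hasForm (Finset.mem_filter.1 hp).2 hfw
      (M := !![a, p.1 * (1 - a); 0, 1]) (by rw [Matrix.isUnit_iff_isUnit_det]; simp [ha])
    exact ⟨P, hP, fun Q hQ => hQ.unique hP⟩
  · exact fun p hp P hP => (rightExt_iff hI hfw P).2 ⟨p.1, p.2, (Finset.mem_filter.1 hp).2, hP⟩
  · intro P hP
    obtain ⟨t, u, heu, hP⟩ := (rightExt_iff hI hfw P).1 hP
    rw [← card_filter_mul_eq (1 - a) t]
    refine Finset.card_nbij' (fun p => p.1) (fun s => (s, u)) ?_ ?_ ?_ ?_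
    · intro p hp
      have := (Finset.mem_filter.1 hp).2
      simpa using (hP.eq_of_pair heu this).2
    · intro s hs
      have hs : s * (1 - a) = t * (1 - a) := by simpa using hs
      simp only [Finset.coe_filter, Set.mem_ofPred_eq, shearPairs, Finset.mem_filter,
        Finset.mem_univ, true_and]
      exact ⟨heu, hs ▸ hP⟩
    · intro p hp
      exact Prod.ext rfl (hP.eq_of_pair heu (Finset.mem_filter.1 hp).2).1.symm
    · exact fun s _ => rfl

open Classical in
theorem leftExt_mean {f w x : Fin n → F} {b : F} (hb : b ≠ 0) {J : PartialIso F n}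
    (hJ : J.HasForm ![w] ![x] !![b]) (hfw : LinearIndependent F ![f, w]) (g : PartialIso F n → A) :
    (Fintype.card (J.LeftExt (Submodule.span F {f, w})) : ℂ)⁻¹ •
      ∑ Q : J.LeftExt (Submodule.span F {f, w}), g Q.1 =
    ((shearPairs x).card : ℂ)⁻¹ • ∑ p ∈ shearPairs x, ∑ Q : PartialIso F n,
      if Q.HasForm ![f, w] ![p.2, x] !![1, 0; p.1 * (1 - b), b] then g Q else 0 := by
  refine mean_eq_of_card_fiber (shearPairs x)
    (fun P => IsTrivialExtension J P ∧ P.left = Submodule.span F {f, w})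
    (fun p P => P.HasForm ![f, w] ![p.2, x] !![1, 0; p.1 * (1 - b), b])
    (Finset.univ.filter fun t : F => t * (1 - b) = 0).card ?_ ?_ ?_ ?_ g
  · exact (Finset.card_pos.2 ⟨0, by simp⟩).ne'
  · intro p hp
    obtain ⟨P, hP⟩ := exists_hasForm hfw (linearIndependent_pair_swap (Finset.mem_filter.1 hp).2)
      (M := !![1, 0; p.1 * (1 - b), b]) (by rw [Matrix.isUnit_iff_isUnit_det]; simp [hb])
    exact ⟨P, hP, fun Q hQ => hQ.unique hP⟩
  · exact fun p hp P hP => (leftExt_iff hJ hfw P).2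
      ⟨p.1, p.2, linearIndependent_pair_swap (Finset.mem_filter.1 hp).2, hP⟩
  · intro P hP
    obtain ⟨t, u, heu, hP⟩ := (leftExt_iff hJ hfw P).1 hP
    rw [← card_filter_mul_eq (1 - b) t]
    refine Finset.card_nbij' (fun p => p.1) (fun s => (s, u)) ?_ ?_ ?_ ?_
    · intro p hp
      have := (Finset.mem_filter.1 hp).2
      simpa using (hP.eq_of_pair_right hfw this).2
    · intro s hs
      have hs : s * (1 - b) = t * (1 - b) := by simpa using hs
      simp only [Finset.coe_filter, Set.mem_ofPred_eq, shearPairs, Finset.mem_filter,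
        Finset.mem_univ, true_and]
      exact ⟨linearIndependent_pair_swap heu, hs ▸ hP⟩
    · intro p hp
      exact Prod.ext rfl (hP.eq_of_pair_right hfw (Finset.mem_filter.1 hp).2).1.symm
    · exact fun s _ => rfl

end PartialIso

/-! ### The product of two basis elements of degree one. -/

namespace PartIsoAlg

variable {F : Type*} [Field F] [Fintype F] {n : ℕ}

open Classical in
/-- The composition of two partial isomorphisms, or zero if they are not composable. -/
def ofComp (P Q : PartialIso F n) : PartIsoAlg F n :=
  if h : P.right = Q.left then of (P.comp Q h) else 0

theorem ofComp_eq_formEl {ι : Type*} [Fintype ι] {e f x : ι → Fin n → F} {M N : Matrix ι ι F}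
    {P Q : PartialIso F n} (hP : P.HasForm e f M) (hQ : Q.HasForm f x N) :
    ofComp P Q = formEl e x (M * N) := by
  have h : P.right = Q.left := hP.2.1.trans hQ.1.symm
  rw [ofComp, dif_pos h, formEl_eq_of (hP.comp hQ h)]

theorem mulBasis_eq_ofComp (I J : PartialIso F n) :
    mulBasis I J = (Fintype.card (I.RightExt (I.right ⊔ J.left)) : ℂ)⁻¹ •
      ∑ P : I.RightExt (I.right ⊔ J.left),
      (Fintype.card (J.LeftExt (I.right ⊔ J.left)) : ℂ)⁻¹ •
      ∑ Q : J.LeftExt (I.right ⊔ J.left), ofComp P.1 Q.1 := by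
  rw [← Finset.smul_sum, smul_smul, mulBasis]
  congr 1
  refine Finset.sum_congr rfl fun P _ => Finset.sum_congr rfl fun Q _ => ?_
  rw [ofComp, dif_pos (P.2.2.trans Q.2.2.symm)]

open PartialIso in
theorem mulBasis_of_linearIndependent {e f w x : Fin n → F} {a b : F} (ha : a ≠ 0) (hb : b ≠ 0)
    {I J : PartialIso F n} (hI : I.HasForm ![e] ![f] !![a]) (hJ : J.HasForm ![w] ![x] !![b])
    (hfw : LinearIndependent F ![f, w]) :
    mulBasis I J = (((shearPairs e).card : ℂ)⁻¹ * ((shearPairs x).card : ℂ)⁻¹) •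
      ∑ p ∈ shearPairs e, ∑ p' ∈ shearPairs x, formEl ![e, p.2] ![p'.2, x]
        (!![a, p.1 * (1 - a); 0, 1] * !![1, 0; p'.1 * (1 - b), b]) := by
  classical
  have hY : I.right ⊔ J.left = Submodule.span F {f, w} := by
    rw [hI.2.1, hJ.1, span_range_single, span_range_single, Submodule.span_insert]
  -- The double mean is treated as a mean over P of means over Q; at each pair of parameters exactly
  -- one P and one Q survive.
  rw [mulBasis_eq_ofComp, hY, rightExt_mean ha hI hfw fun P =>
    (Fintype.card (J.LeftExt (Submodule.span F {f, w})) : ℂ)⁻¹ •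
      ∑ Q : J.LeftExt (Submodule.span F {f, w}), ofComp P Q.1, mul_smul]
  congr 1
  rw [Finset.smul_sum]
  refine Finset.sum_congr rfl fun p hp => ?_
  obtain ⟨P, hP⟩ := exists_hasForm (Finset.mem_filter.1 hp).2 hfw
    (M := !![a, p.1 * (1 - a); 0, 1]) (by rw [Matrix.isUnit_iff_isUnit_det]; simp [ha])
  rw [hP.sum_ite, leftExt_mean hb hJ hfw]
  congr 1
  refine Finset.sum_congr rfl fun p' hp' => ?_
  obtain ⟨Q, hQ⟩ := exists_hasForm hfw (linearIndependent_pair_swap (Finset.mem_filter.1 hp').2)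
    (M := !![1, 0; p'.1 * (1 - b), b]) (by rw [Matrix.isUnit_iff_isUnit_det]; simp [hb])
  rw [hQ.sum_ite, ofComp_eq_formEl hP hQ]

end PartIsoAlg

namespace PartialIso

variable {F : Type*} [Field F] {n : ℕ}

theorem isTrivialExtension_refl (I : PartialIso F n) : IsTrivialExtension I I := by
  refine ⟨⟨le_rfl, le_rfl, fun x y h => ?_, fun x y h => ?_⟩, ⊥, ⊥, disjoint_bot_right, by simp,
    disjoint_bot_right, by simp, fun x hx => ?_, fun x hx => ?_⟩
  · rw [Subtype.ext h]
  · rw [Subtype.ext h]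
  · have : x = 0 := Subtype.ext (by simpa using hx)
    simp [this]
  · have : x = 0 := Subtype.ext (by simpa using hx)
    simp [this]

/-- The two subspaces of a partial isomorphism have the same dimension, so an extension that does
not enlarge one of them does not enlarge the other. -/
theorem IsExtension.eq_of_eq {I J : PartialIso F n} (h : IsExtension I J)
    (h' : J.right = I.right ∨ J.left = I.left) : J = I := by
  have e1 := I.fwd.finrank_eq
  have e2 := J.fwd.finrank_eq
  have hl : I.left = J.left := by
    rcases h' with h' | h'
    · refine Submodule.eq_of_le_of_finrank_eq h.1 ?_
      rw [e1, e2, h']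
    · exact h'.symm
  have hr : I.right = J.right := by
    rcases h' with h' | h'
    · exact h'.symm
    · refine Submodule.eq_of_le_of_finrank_eq h.2.1 ?_
      rw [← e1, ← e2, h']
  obtain ⟨L, R, g, g'⟩ := I
  obtain ⟨L', R', k, k'⟩ := J
  obtain rfl : L = L' := hl
  obtain rfl : R = R' := hr
  congr 1
  · exact LinearEquiv.ext fun x => Subtype.ext (h.2.2.1 x x rfl).symm
  · exact LinearEquiv.ext fun x => Subtype.ext (h.2.2.2 x x rfl).symm

end PartialIso

namespace PartIsoAlg

variable {F : Type*} [Field F] [Fintype F] {n : ℕ}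

/-- Each factor is its only trivial extension to the common subspace, so both means have a single
term. -/
theorem mulBasis_of_right_eq_left {I J : PartialIso F n} (h : I.right = J.left) :
    mulBasis I J = ofComp I J := by
  have hY : I.right ⊔ J.left = I.right := by rw [h, sup_idem]
  have hY' : I.right ⊔ J.left = J.left := by rw [h, sup_idem]
  let P₀ : I.RightExt (I.right ⊔ J.left) := ⟨I, I.isTrivialExtension_refl, hY.symm⟩
  let Q₀ : J.LeftExt (I.right ⊔ J.left) := ⟨J, J.isTrivialExtension_refl, hY'.symm⟩
  let u₁ : Unique (I.RightExt (I.right ⊔ J.left)) :=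
    ⟨⟨P₀⟩, fun P => Subtype.ext (P.2.1.1.eq_of_eq (Or.inl (P.2.2.trans hY)))⟩
  let u₂ : Unique (J.LeftExt (I.right ⊔ J.left)) :=
    ⟨⟨Q₀⟩, fun P => Subtype.ext (P.2.1.1.eq_of_eq (Or.inr (P.2.2.trans hY')))⟩
  rw [mulBasis_eq_ofComp, Fintype.card_eq_one_iff.2 ⟨P₀, fun P => u₁.uniq P⟩,
    Fintype.card_eq_one_iff.2 ⟨Q₀, fun P => u₂.uniq P⟩, Nat.cast_one, inv_one, one_smul]
  simp only [one_smul]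
  exact (Fintype.sum_unique _).trans
    (Fintype.sum_unique fun Q : J.LeftExt (I.right ⊔ J.left) => ofComp I Q.1)

theorem of_mul_of (I J : PartialIso F n) : of I * of J = mulBasis I J := by
  change (Finsupp.linearCombination ℂ (fun I => lift fun J => mulBasis I J)
    (Finsupp.single I 1)) (of J) = _
  rw [Finsupp.linearCombination_single, one_smul]
  refine (Finsupp.linearCombination_single ℂ (1 : ℂ) J).trans ?_
  rw [one_smul]

theorem sum_mul' {α : Type*} (s : Finset α) (x : α → PartIsoAlg F n) (y : PartIsoAlg F n) :
    (∑ i ∈ s, x i) * y = ∑ i ∈ s, x i * y := by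
  change mulLin (∑ i ∈ s, x i) y = _
  rw [map_sum, LinearMap.sum_apply]
  rfl

theorem mul_sum' {α : Type*} (s : Finset α) (x : PartIsoAlg F n) (y : α → PartIsoAlg F n) :
    x * (∑ i ∈ s, y i) = ∑ i ∈ s, x * y i := map_sum (mulLin x) y s

theorem smul_mul_smul' (c d : ℂ) (x y : PartIsoAlg F n) : (c • x) * (d • y) = (c * d) • (x * y) := by
  change mulLin (c • x) (d • y) = (c * d) • mulLin x y
  rw [map_smul, map_smul, LinearMap.smul_apply, smul_smul, mul_comm]

end PartIsoAlg

/-! ### The product of two sums of degree one, and its normalization. -/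

section product

open PartialIso

variable {F : Type*} [Field F] {n : ℕ}

theorem linearIndependent_single_iff (v : Fin n → F) : LinearIndependent F ![v] ↔ v ≠ 0 := by
  rw [linearIndependent_unique_iff]; simp

theorem exists_hasForm_single {e f : Fin n → F} {a : F} (ha : a ≠ 0) (he : e ≠ 0) (hf : f ≠ 0) :
    ∃ I : PartialIso F n, I.HasForm ![e] ![f] !![a] :=
  exists_hasForm ((linearIndependent_single_iff e).2 he) ((linearIndependent_single_iff f).2 hf)
    (by rw [Matrix.isUnit_iff_isUnit_det]; simp [ha])

theorem PartialIso.HasForm.single_smul {e f : Fin n → F} {a : F} {I : PartialIso F n}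
    (h : I.HasForm ![e] ![f] !![a]) (c : Fˣ) :
    I.HasForm ![(c : F) • e] ![(c : F) • f] !![a] := by
  have := PartialIso.HasForm.of_columns h (h := !![(c : F)]) (N := !![a])
    (by rw [Matrix.isUnit_iff_isUnit_det]; simp)
    (by ext i j; fin_cases i; fin_cases j; simp [Matrix.mul_apply, mul_comm])
  convert this using 1 <;> (funext i; fin_cases i; simp)

variable [Fintype F]

open Classical in
variable (F n) in
/-- The nonzero vectors. -/
def nonzeroVectors : Finset (Fin n → F) := Finset.univ.filter fun v => v ≠ 0

open Classical in
variable (F n) in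
/-- The free pairs of vectors. -/
def freePairs : Finset ((Fin n → F) × (Fin n → F)) :=
  Finset.univ.filter fun p => LinearIndependent F ![p.1, p.2]

theorem mem_nonzeroVectors {v : Fin n → F} : v ∈ nonzeroVectors F n ↔ v ≠ 0 := by
  simp [nonzeroVectors]

theorem mem_freePairs {p : (Fin n → F) × (Fin n → F)} :
    p ∈ freePairs F n ↔ LinearIndependent F ![p.1, p.2] := by
  simp [freePairs]

open Classical in
/-- The vectors that form a free family with a given vector. -/
def completions (e : Fin n → F) : Finset (Fin n → F) :=
  Finset.univ.filter fun u => LinearIndependent F ![e, u]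

theorem mem_completions {e u : Fin n → F} : u ∈ completions e ↔ LinearIndependent F ![e, u] := by
  simp [completions]

theorem sum_freeFamily_one {A : Type*} [AddCommMonoid A] (g : (Fin 1 → Fin n → F) → A) :
    ∑ e : FreeFamily F n (Fin 1), g e.1 = ∑ v ∈ nonzeroVectors F n, g ![v] := by
  refine Finset.sum_bij' (fun e _ => e.1 0)
    (fun v hv => ⟨![v], (linearIndependent_single_iff v).2 (mem_nonzeroVectors.1 hv)⟩) ?_ ?_ ?_ ?_ ?_
  · exact fun e _ => mem_nonzeroVectors.2 (e.2.ne_zero 0)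
  · exact fun _ _ => Finset.mem_univ _
  · exact fun e _ => Subtype.ext (by funext i; fin_cases i; rfl)
  · exact fun _ _ => rfl
  · exact fun e _ => congrArg g (by funext i; fin_cases i; rfl)

theorem sum_freeFamily_two {A : Type*} [AddCommMonoid A] (g : (Fin 2 → Fin n → F) → A) :
    ∑ e : FreeFamily F n (Fin 2), g e.1 = ∑ p ∈ freePairs F n, g ![p.1, p.2] := by
  have h : ∀ e : Fin 2 → Fin n → F, ![e 0, e 1] = e := fun e => by
    funext i; fin_cases i <;> rfl
  refine Finset.sum_bij' (fun e _ => (e.1 0, e.1 1))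
    (fun p hp => ⟨![p.1, p.2], (mem_freePairs.1 hp)⟩) ?_ ?_ ?_ ?_ ?_
  · exact fun e _ => mem_freePairs.2 (by rw [h]; exact e.2)
  · exact fun _ _ => Finset.mem_univ _
  · exact fun e _ => Subtype.ext (h e.1)
  · exact fun _ _ => rfl
  · exact fun e _ => congrArg g (h e.1).symm

theorem formSum_one (M : Matrix (Fin 1) (Fin 1) F) (n : ℕ) :
    formSum M n = ∑ e ∈ nonzeroVectors F n, ∑ f ∈ nonzeroVectors F n, formEl ![e] ![f] M := by
  unfold formSum
  rw [← sum_freeFamily_one fun e => ∑ f ∈ nonzeroVectors F n, formEl e ![f] M]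
  exact Finset.sum_congr rfl fun e _ => sum_freeFamily_one fun f => formEl e.1 f M

theorem formSum_two (M : Matrix (Fin 2) (Fin 2) F) (n : ℕ) :
    formSum M n = ∑ p ∈ freePairs F n, ∑ p' ∈ freePairs F n,
      formEl ![p.1, p.2] ![p'.1, p'.2] M := by
  unfold formSum
  rw [← sum_freeFamily_two fun e => ∑ p' ∈ freePairs F n, formEl e ![p'.1, p'.2] M]
  exact Finset.sum_congr rfl fun e _ => sum_freeFamily_two fun f => formEl e.1 f M

theorem card_nonzeroVectors :
    ((nonzeroVectors F n).card : ℂ) = (Fintype.card F : ℂ) ^ n - 1 := by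
  classical
  have h := Finset.card_filter_add_card_filter_not (s := (Finset.univ : Finset (Fin n → F)))
    (fun v => v ≠ 0)
  have h2 : (Finset.univ.filter fun v : Fin n → F => ¬ v ≠ 0).card = 1 := by
    rw [Finset.card_eq_one]; exact ⟨0, by ext; simp⟩
  rw [h2, Finset.card_univ, Fintype.card_fun, Fintype.card_fin] at h
  rw [eq_sub_iff_add_eq]
  unfold nonzeroVectors
  exact_mod_cast h

theorem card_completions {e : Fin n → F} (he : e ≠ 0) :
    ((completions e).card : ℂ) = (Fintype.card F : ℂ) ^ n - Fintype.card F := by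
  classical
  have h := Finset.card_filter_add_card_filter_not (s := (Finset.univ : Finset (Fin n → F)))
    (fun u => LinearIndependent F ![e, u])
  have h2 : (Finset.univ.filter fun u : Fin n → F => ¬ LinearIndependent F ![e, u]) =
      Finset.univ.image fun c : F => c • e := by
    ext u
    simp [LinearIndependent.pair_iff' he]
  rw [h2, Finset.card_image_of_injective _ (smul_left_injective F he), Finset.card_univ,
    Finset.card_univ, Fintype.card_fun, Fintype.card_fin] at h
  rw [eq_sub_iff_add_eq]
  unfold completions
  exact_mod_cast h

theorem sum_freePairs {A : Type*} [AddCommMonoid A] (g : (Fin n → F) → (Fin n → F) → A) :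
    ∑ p ∈ freePairs F n, g p.1 p.2 =
      ∑ e ∈ nonzeroVectors F n, ∑ u ∈ completions e, g e u := by
  classical
  have : freePairs F n = (nonzeroVectors F n ×ˢ Finset.univ).filter
      fun p => LinearIndependent F ![p.1, p.2] := by
    ext p
    simp only [freePairs, nonzeroVectors, Finset.mem_filter, Finset.mem_univ, true_and,
      Finset.mem_product, and_true]
    exact ⟨fun h => ⟨h.ne_zero 0, h⟩, fun h => h.2⟩
  rw [this, Finset.sum_filter, Finset.sum_product]
  exact Finset.sum_congr rfl fun e _ => (Finset.sum_filter _ _).symm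

theorem sum_shearPairs {A : Type*} [AddCommMonoid A] (e : Fin n → F) (g : F → (Fin n → F) → A) :
    ∑ p ∈ shearPairs e, g p.1 p.2 =
      ∑ t, ∑ u ∈ completions e, g t u := by
  classical
  unfold shearPairs
  rw [Finset.sum_filter, Fintype.sum_prod_type]
  exact Finset.sum_congr rfl fun e _ => (Finset.sum_filter _ _).symm

theorem card_shearPairs {e : Fin n → F} (he : e ≠ 0) : ((shearPairs e).card : ℂ) =
    Fintype.card F * ((Fintype.card F : ℂ) ^ n - Fintype.card F) := by
  classical
  have := sum_shearPairs e fun _ _ => (1 : ℂ)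
  rw [Finset.sum_const, nsmul_one] at this
  rw [this, ← card_completions he, ← nsmul_eq_mul]
  refine Finset.sum_eq_card_nsmul fun t _ => ?_
  rw [Finset.sum_const, nsmul_one]

theorem sum_sum_shearPairs_left {A : Type*} [AddCommMonoid A]
    (g : F → (Fin n → F) → (Fin n → F) → A) :
    ∑ e ∈ nonzeroVectors F n, ∑ p ∈ shearPairs e, g p.1 e p.2 =
      ∑ t, ∑ p ∈ freePairs F n, g t p.1 p.2 := by
  classical
  simp only [sum_freePairs]
  rw [Finset.sum_comm]
  exact Finset.sum_congr rfl fun e _ => sum_shearPairs e fun t u => g t e u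

theorem sum_sum_shearPairs_right {A : Type*} [AddCommMonoid A]
    (g : F → (Fin n → F) → (Fin n → F) → A) :
    ∑ x ∈ nonzeroVectors F n, ∑ p ∈ shearPairs x, g p.1 p.2 x =
      ∑ t, ∑ p ∈ freePairs F n, g t p.1 p.2 := by
  rw [sum_sum_shearPairs_left fun t x y => g t y x]
  refine Finset.sum_congr rfl fun t _ => ?_
  refine Finset.sum_nbij' Prod.swap Prod.swap ?_ ?_ ?_ ?_ ?_ <;>
    simp +contextual [freePairs, linearIndependent_pair_swap]

theorem sum_nonzeroVectors [DecidableEq F] {A : Type*} [AddCommMonoid A] {f : Fin n → F} (hf : f ≠ 0)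
    (g : (Fin n → F) → A) :
    ∑ w ∈ nonzeroVectors F n, g w = ∑ w ∈ completions f, g w + ∑ c : Fˣ, g ((c : F) • f) := by
  classical
  rw [← Finset.sum_filter_add_sum_filter_not _ (fun w => LinearIndependent F ![f, w])]
  congr 1
  · refine Finset.sum_congr ?_ fun _ _ => rfl
    ext w
    rw [Finset.mem_filter, mem_completions, mem_nonzeroVectors]
    exact ⟨fun h => h.2, fun h => ⟨h.ne_zero 1, h⟩⟩
  · refine (Finset.sum_bij (fun (c : Fˣ) _ => (c : F) • f) ?_ ?_ ?_ fun _ _ => rfl).symm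
    · intro c _
      rw [Finset.mem_filter, mem_nonzeroVectors, LinearIndependent.pair_iff' hf]
      exact ⟨smul_ne_zero c.ne_zero hf, fun h => h c rfl⟩
    · exact fun c _ d _ h => Units.ext (smul_left_injective F hf h)
    · intro w hw
      rw [Finset.mem_filter, mem_nonzeroVectors, LinearIndependent.pair_iff' hf] at hw
      obtain ⟨hw0, hw⟩ := hw
      push Not at hw
      obtain ⟨c, rfl⟩ := hw
      exact ⟨Units.mk0 c (fun h => hw0 (by rw [h, zero_smul])), Finset.mem_univ _, rfl⟩

theorem formEl_mul_formEl_smul {e f x : Fin n → F} {a b : F} (ha : a ≠ 0) (hb : b ≠ 0)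
    (he : e ≠ 0) (hf : f ≠ 0) (hx : x ≠ 0) (c : Fˣ) :
    formEl ![e] ![f] !![a] * formEl ![(c : F) • f] ![x] !![b] =
      formEl ![e] ![((c⁻¹ : Fˣ) : F) • x] !![a * b] := by
  obtain ⟨I, hI⟩ := exists_hasForm_single ha he hf
  obtain ⟨J, hJ⟩ := exists_hasForm_single hb (smul_ne_zero c.ne_zero hf) hx
  -- Rescaling both vectors by c⁻¹ keeps the 1 × 1 matrix and makes the middle vectors equal, so
  -- that the forms can be composed.
  have hJ' := hJ.single_smul c⁻¹
  rw [smul_smul, Units.inv_mul, one_smul] at hJ'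
  rw [formEl_eq_of hI, formEl_eq_of hJ, PartIsoAlg.of_mul_of,
    PartIsoAlg.mulBasis_of_right_eq_left (hI.2.1.trans hJ'.1.symm),
    PartIsoAlg.ofComp_eq_formEl hI hJ']
  congr 1
  ext i j; fin_cases i; fin_cases j; simp [Matrix.mul_apply]

theorem formEl_mul_formEl_of_linearIndependent {e f w x : Fin n → F} {a b : F} (ha : a ≠ 0)
    (hb : b ≠ 0) (he : e ≠ 0) (hx : x ≠ 0) (hfw : LinearIndependent F ![f, w]) :
    formEl ![e] ![f] !![a] * formEl ![w] ![x] !![b] =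
      (((Fintype.card F * ((Fintype.card F : ℂ) ^ n - Fintype.card F))⁻¹) ^ 2) •
      ∑ p ∈ shearPairs e, ∑ p' ∈ shearPairs x, formEl ![e, p.2] ![p'.2, x]
        (!![a, p.1 * (1 - a); 0, 1] * !![1, 0; p'.1 * (1 - b), b]) := by
  obtain ⟨I, hI⟩ := exists_hasForm_single (f := f) ha he (hfw.ne_zero 0)
  obtain ⟨J, hJ⟩ := exists_hasForm_single (e := w) hb (hfw.ne_zero 1) hx
  rw [formEl_eq_of hI, formEl_eq_of hJ, PartIsoAlg.of_mul_of,
    PartIsoAlg.mulBasis_of_linearIndependent ha hb hI hJ hfw, card_shearPairs he,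
    card_shearPairs hx, sq]

/-- After summation over x, the contribution of (f, w) depends only on whether f and w are
collinear. There are (qⁿ - 1)(q - 1) collinear pairs and (qⁿ - 1)(qⁿ - q) free ones; q(qⁿ - q) is
the number of parameters (t, u) for each factor. -/
theorem formSum_mul_formSum {a b : F} (ha : a ≠ 0) (hb : b ≠ 0) (n : ℕ) :
    formSum !![a] n * formSum !![b] n =
      (((Fintype.card F : ℂ) - 1) * ((Fintype.card F : ℂ) ^ n - 1)) • formSum !![a * b] n +
      (((Fintype.card F : ℂ) ^ n - 1) * ((Fintype.card F : ℂ) ^ n - Fintype.card F) *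
        ((Fintype.card F * ((Fintype.card F : ℂ) ^ n - Fintype.card F))⁻¹) ^ 2) •
      ∑ t, ∑ s, formSum (!![a, t * (1 - a); 0, 1] * !![1, 0; s * (1 - b), b]) n := by
  classical
  set q : ℂ := (Fintype.card F : ℂ) with hq
  set N := nonzeroVectors F n with hN
  have key : ∀ e ∈ N, ∑ f ∈ N, ∑ w ∈ N, ∑ x ∈ N,
      formEl ![e] ![f] !![a] * formEl ![w] ![x] !![b] =
      ((q - 1) * (q ^ n - 1)) • ∑ x ∈ N, formEl ![e] ![x] !![a * b] +
      ((q ^ n - 1) * (q ^ n - q) * ((q * (q ^ n - q))⁻¹) ^ 2) •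
      ∑ x ∈ N, ∑ p ∈ shearPairs e, ∑ p' ∈ shearPairs x, formEl ![e, p.2] ![p'.2, x]
        (!![a, p.1 * (1 - a); 0, 1] * !![1, 0; p'.1 * (1 - b), b]) := by
    intro e he
    have he := mem_nonzeroVectors.1 he
    have h1 : ∀ f ∈ N, ∑ w ∈ N, ∑ x ∈ N, formEl ![e] ![f] !![a] * formEl ![w] ![x] !![b] =
      (q - 1) • ∑ x ∈ N, formEl ![e] ![x] !![a * b] +
      ((q ^ n - q) * ((q * (q ^ n - q))⁻¹) ^ 2) •
      ∑ x ∈ N, ∑ p ∈ shearPairs e, ∑ p' ∈ shearPairs x, formEl ![e, p.2] ![p'.2, x]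
        (!![a, p.1 * (1 - a); 0, 1] * !![1, 0; p'.1 * (1 - b), b]) := by
      intro f hf
      have hf := mem_nonzeroVectors.1 hf
      rw [sum_nonzeroVectors hf, add_comm]
      congr 1
      · have : ∀ c : Fˣ, ∑ x ∈ N, formEl ![e] ![f] !![a] * formEl ![(c : F) • f] ![x] !![b] =
            ∑ x ∈ N, formEl ![e] ![x] !![a * b] := by
          intro c
          rw [Finset.sum_congr rfl fun x hx =>
            formEl_mul_formEl_smul ha hb he hf (mem_nonzeroVectors.1 hx) c]
          -- The scalar c is absorbed by the summation over x.
          refine Finset.sum_nbij' (fun x => ((c⁻¹ : Fˣ) : F) • x) (fun x => (c : F) • x)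
            ?_ ?_ ?_ ?_ fun _ _ => rfl
          · exact fun x hx => mem_nonzeroVectors.2
              (smul_ne_zero (Units.ne_zero _) (mem_nonzeroVectors.1 hx))
          · exact fun x hx => mem_nonzeroVectors.2
              (smul_ne_zero (Units.ne_zero _) (mem_nonzeroVectors.1 hx))
          · exact fun x _ => by simp
          · exact fun x _ => by simp
        rw [Finset.sum_congr rfl fun c _ => this c, Finset.sum_const, Finset.card_univ,
          ← Nat.cast_smul_eq_nsmul ℂ, Fintype.card_units, Nat.cast_sub Fintype.card_pos]
        simp [hq]
      · rw [Finset.sum_congr rfl fun w hw => Finset.sum_congr rfl fun x hx =>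
          formEl_mul_formEl_of_linearIndependent ha hb he (mem_nonzeroVectors.1 hx)
            (mem_completions.1 hw), Finset.sum_const, ← Nat.cast_smul_eq_nsmul ℂ,
          card_completions hf, ← Finset.smul_sum, smul_smul]
    rw [Finset.sum_congr rfl h1, Finset.sum_const, ← Nat.cast_smul_eq_nsmul ℂ,
      card_nonzeroVectors, smul_add, smul_smul, smul_smul]
    congr 2 <;> ring
  rw [formSum_one !![a], formSum_one !![b], formSum_one !![a * b]]
  simp only [PartIsoAlg.sum_mul']
  simp only [PartIsoAlg.mul_sum', ← hN]
  rw [Finset.sum_congr rfl key, Finset.sum_add_distrib, ← Finset.smul_sum, ← Finset.smul_sum]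
  congr 2
  calc _ = ∑ e ∈ N, ∑ p ∈ shearPairs e, ∑ s, ∑ p' ∈ freePairs F n,
        formEl ![e, p.2] ![p'.1, p'.2]
          (!![a, p.1 * (1 - a); 0, 1] * !![1, 0; s * (1 - b), b]) := by
        refine Finset.sum_congr rfl fun e _ => ?_
        rw [Finset.sum_comm]
        refine Finset.sum_congr rfl fun p _ => ?_
        exact sum_sum_shearPairs_right fun s y x => formEl ![e, p.2] ![y, x]
          (!![a, p.1 * (1 - a); 0, 1] * !![1, 0; s * (1 - b), b])
    _ = _ := by
        rw [sum_sum_shearPairs_left fun t e u => ∑ s, ∑ p' ∈ freePairs F n,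
          formEl ![e, u] ![p'.1, p'.2] (!![a, t * (1 - a); 0, 1] * !![1, 0; s * (1 - b), b])]
        refine Finset.sum_congr rfl fun t _ => ?_
        rw [Finset.sum_comm]
        exact Finset.sum_congr rfl fun s _ => (formSum_two _ n).symm

/-- The normalization factor of the classes of size `k`. -/
def normFactor (q : ℂ) (k n : ℕ) : ℂ := pochInv q (n - k) / (q ^ (n * k) * pochInv q n)

/-- When n < 2 the subtraction n - 2 is truncated and the normalizing factor has no meaning; the
vanishing of the sum makes its value irrelevant. -/
theorem formSum_two_eq_zero (M : Matrix (Fin 2) (Fin 2) F) {n : ℕ} (hn : n < 2) :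
    formSum M n = 0 := by
  have : IsEmpty (FreeFamily F n (Fin 2)) := ⟨fun e => by
    have := e.2.fintype_card_le_finrank
    simp at this
    omega⟩
  simp [formSum]

theorem formSum_one_eq_zero (M : Matrix (Fin 1) (Fin 1) F) : formSum M 0 = 0 := by
  have : IsEmpty (FreeFamily F 0 (Fin 1)) := ⟨fun e => by
    have := e.2.fintype_card_le_finrank
    simp at this⟩
  simp [formSum]

theorem normFactor_one {q : ℂ} (hq : q ≠ 0) (hp : ∀ m, pochInv q m ≠ 0) {n : ℕ} (hn : 1 ≤ n) :
    normFactor q 1 n = (q ^ n - 1)⁻¹ := by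
  obtain ⟨m, rfl⟩ := Nat.exists_eq_add_of_le' hn
  have h1 : pochInv q (m + 1) = pochInv q m * (1 - (q ^ (m + 1))⁻¹) := Finset.prod_range_succ _ _
  have h2 := hp m
  rw [normFactor, h1, mul_one, Nat.add_sub_cancel]
  have h3 : q ^ (m + 1) * (pochInv q m * (1 - (q ^ (m + 1))⁻¹)) =
      pochInv q m * (q ^ (m + 1) - 1) := by
    field_simp
  rw [h3, div_mul_eq_div_div, div_self h2, one_div]

theorem normFactor_two {q : ℂ} (hq : q ≠ 0) (hp : ∀ m, pochInv q m ≠ 0) {n : ℕ} (hn : 2 ≤ n) :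
    normFactor q 2 n = ((q ^ n - 1) * (q ^ n - q))⁻¹ := by
  obtain ⟨m, rfl⟩ := Nat.exists_eq_add_of_le' hn
  have h1 : pochInv q (m + 2) = pochInv q m * (1 - (q ^ (m + 1))⁻¹) * (1 - (q ^ (m + 2))⁻¹) := by
    unfold pochInv
    rw [Finset.prod_range_succ, Finset.prod_range_succ]
  have h2 := hp m
  rw [normFactor, h1, Nat.add_sub_cancel]
  have h3 : q ^ ((m + 2) * 2) * (pochInv q m * (1 - (q ^ (m + 1))⁻¹) * (1 - (q ^ (m + 2))⁻¹)) =
      pochInv q m * ((q ^ (m + 2) - 1) * (q ^ (m + 2) - q)) := by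
    field_simp
    ring
  rw [h3, div_mul_eq_div_div, div_self h2, one_div]

/-- The normalizing factors are 1/(qⁿ - 1) and 1/((qⁿ - 1)(qⁿ - q)), the inverses of the numbers of
free families. All powers qⁿ cancel, leaving the coefficients q - 1 and q⁻². -/
theorem normFactor_smul_mul {a b : F} (ha : a ≠ 0) (hb : b ≠ 0) {q : ℂ} (hq : q = Fintype.card F)
    (n : ℕ) :
    (normFactor q 1 n • formSum !![a] n) * (normFactor q 1 n • formSum !![b] n) =
      (q - 1) • normFactor q 1 n • formSum !![a * b] n +
      (q ^ 2)⁻¹ • ∑ t, ∑ s, normFactor q 2 n •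
        formSum !![a + t * (1 - a) * (s * (1 - b)), t * (1 - a) * b; s * (1 - b), b] n := by
  have hm : ∀ t s : F, !![a, t * (1 - a); 0, 1] * !![1, 0; s * (1 - b), b] =
      !![a + t * (1 - a) * (s * (1 - b)), t * (1 - a) * b; s * (1 - b), b] := by
    intro t s
    ext i j; fin_cases i <;> fin_cases j <;> simp [Matrix.mul_apply, Fin.sum_univ_two]
  have hq1 : 1 < Fintype.card F := Fintype.one_lt_card
  have hq0 : q ≠ 0 := by rw [hq]; exact_mod_cast Fintype.card_ne_zero
  have hp : ∀ m, pochInv q m ≠ 0 := fun m => hq ▸ pochInv_card_ne_zero m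
  rw [PartIsoAlg.smul_mul_smul', formSum_mul_formSum ha hb, ← hq, smul_add, smul_smul, smul_smul]
  simp only [hm, ← Finset.smul_sum, smul_smul]
  have hpow : ∀ i j : ℕ, i ≠ j → q ^ i - q ^ j ≠ 0 := by
    intro i j hij h
    rw [hq, sub_eq_zero] at h
    exact hij (Nat.pow_right_injective hq1 (by exact_mod_cast h))
  rcases Nat.lt_or_ge n 2 with hn | hn
  -- For n < 2 there are no free pairs and only the collinear part is left; for n = 0 it vanishes
  -- too.
  · simp only [formSum_two_eq_zero _ hn, Finset.sum_const_zero, smul_zero, add_zero]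
    rcases Nat.lt_or_ge n 1 with hn' | hn'
    · obtain rfl : n = 0 := by omega
      rw [formSum_one_eq_zero, smul_zero, smul_zero]
    · have h1 := hpow n 0 (by omega)
      rw [pow_zero] at h1
      rw [normFactor_one hq0 hp hn']
      congr 1
      field_simp
  · have h1 := hpow n 0 (by omega)
    have h2 := hpow n 1 (by omega)
    rw [pow_zero] at h1
    rw [pow_one] at h2
    rw [normFactor_one hq0 hp (by omega), normFactor_two hq0 hp hn]
    congr 2 <;> field_simp

end product

theorem jordanBlock_cast {F : Type*} [Field F] {p p' : F[X]} (h : p = p') (i j : Fin p.natDegree) :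
    jordanBlock p i j = jordanBlock p' (finCongr (congrArg natDegree h) i)
      (finCongr (congrArg natDegree h) j) := by
  subst h; rfl

/-! ### Normalized classes of matrices and their comparison with generic classes. -/

section matClass

variable {F : Type*} [Field F] [Fintype F] {ι κ : Type*} [Fintype ι] [Fintype κ]

/-- The normalized class of a matrix. -/
def matClass (M : Matrix ι ι F) : ∀ n, PartIsoAlg F n := fun n =>
  normFactor (Fintype.card F) (Fintype.card ι) n • formSum M n

theorem genericClass_val (μ : Polypartition F) : (genericClass μ).1 = matClass μ.jordan := by
  funext n
  rw [matClass, Polypartition.card_index]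
  rfl

theorem matClass_reindex (σ : ι ≃ κ) (M : Matrix ι ι F) (N : Matrix κ κ F)
    (h : ∀ i j, M i j = N (σ i) (σ j)) : matClass M = matClass N := by
  funext n
  rw [matClass, matClass, formSum_reindex σ M N h, Fintype.card_congr σ]

theorem matClass_eq_of_conj [DecidableEq ι] (h M N : Matrix ι ι F) (hh : IsUnit h)
    (hM : M * h = h * N) : matClass M = matClass N := by
  funext n
  rw [matClass, matClass, formSum_eq_of_conj h M N hh hM]

theorem matClass_mul_matClass {a b : F} (ha : a ≠ 0) (hb : b ≠ 0) {q : ℂ}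
    (hq : q = Fintype.card F) :
    matClass !![a] * matClass !![b] = (q - 1) • matClass !![a * b] +
      (q ^ 2)⁻¹ • ∑ t, ∑ s, matClass
        !![a + t * (1 - a) * (s * (1 - b)), t * (1 - a) * b; s * (1 - b), b] := by
  funext n
  have := normFactor_smul_mul ha hb hq n
  simp only [Pi.mul_apply, Pi.add_apply, Pi.smul_apply, Finset.sum_apply, matClass,
    Fintype.card_fin, ← hq]
  exact this

/-- A nonscalar 2 × 2 matrix M has a cyclic vector v, and in the basis (v, Mv) it is the companion
matrix of its characteristic polynomial. The conjugating matrices have columns v, Mv, with v = (1,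
1), (0, 1) or (1, 0) according to which entries vanish. -/
theorem matClass_eq_companion {x y z w : F} (h : y ≠ 0 ∨ z ≠ 0 ∨ x ≠ w) :
    matClass !![x, y; z, w] = matClass !![0, -(x * w - y * z); 1, x + w] := by
  by_cases hz : z = 0
  · by_cases hy : y = 0
    · have hxw : x ≠ w := by tauto
      refine matClass_eq_of_conj !![1, x; 1, w] _ _ ?_ ?_
      · rw [Matrix.isUnit_iff_isUnit_det]
        simpa [sub_eq_zero] using hxw.symm
      · subst hz hy
        ext i j; fin_cases i <;> fin_cases j <;> simp [Matrix.mul_apply, Fin.sum_univ_two] <;> ring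
    · refine matClass_eq_of_conj !![0, y; 1, w] _ _ ?_ ?_
      · rw [Matrix.isUnit_iff_isUnit_det]
        simpa using hy
      · ext i j; fin_cases i <;> fin_cases j <;> simp [Matrix.mul_apply, Fin.sum_univ_two] <;> ring
  · refine matClass_eq_of_conj !![1, x; 0, z] _ _ ?_ ?_
    · rw [Matrix.isUnit_iff_isUnit_det]
      simpa using hz
    · ext i j; fin_cases i <;> fin_cases j <;> simp [Matrix.mul_apply, Fin.sum_univ_two] <;> ring

theorem genericClass_singleton (P : PolyLabel F) (i : ℕ+) :
    (genericClass {(P, i)}).1 = matClass (jordanBlock (P.1 ^ (i : ℕ))) := by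
  classical
  rw [genericClass_val]
  set μ : Polypartition F := {(P, i)} with hμ
  have hc : Fintype.card μ.ToType = 1 := by
    rw [Multiset.card_coe, hμ, Multiset.card_singleton]
  let u : Unique μ.ToType := (Fintype.card_eq_one_iff_nonempty_unique.1 hc).some
  have hu : (default : μ.ToType).1 = (P, i) :=
    Multiset.mem_singleton.1 (Multiset.coe_mem (m := μ) (x := default))
  have hb : μ.block default = P.1 ^ (i : ℕ) := by
    rw [Polypartition.block, hu]
  let σ : μ.Index ≃ Fin (P.1 ^ (i : ℕ)).natDegree :=
    (Equiv.uniqueSigma fun x => Fin (μ.block x).natDegree).trans (finCongr (congrArg natDegree hb))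
  refine (matClass_reindex σ.symm _ _ fun k l => ?_).symm
  obtain ⟨k, rfl⟩ := (finCongr (congrArg natDegree hb)).surjective k
  obtain ⟨l, rfl⟩ := (finCongr (congrArg natDegree hb)).surjective l
  have h1 : ∀ k, σ.symm (finCongr (congrArg natDegree hb) k) = ⟨default, k⟩ := fun k => by
    rw [Equiv.symm_apply_eq]; rfl
  rw [h1, h1, Polypartition.jordan, Matrix.blockDiagonal'_apply_eq, jordanBlock_cast hb]

theorem matClass_jordanBlock_of_natDegree_eq_one {p : F[X]} (hp : p.natDegree = 1) :
    matClass (jordanBlock p) = matClass !![-p.coeff 0] := by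
  refine matClass_reindex (finCongr hp) _ _ fun i j => ?_
  have hi : (i : ℕ) = 0 := by omega
  have hj : (j : ℕ) = 0 := by omega
  simp [jordanBlock, hi, hj, hp]

theorem matClass_jordanBlock_of_natDegree_eq_two {p : F[X]} (hp : p.natDegree = 2) :
    matClass (jordanBlock p) = matClass !![0, -p.coeff 0; 1, -p.coeff 1] := by
  refine (matClass_reindex (finCongr hp.symm) _ _ fun i j => ?_).symm
  fin_cases i <;> fin_cases j <;> simp [jordanBlock, hp]

theorem genericClass_linLabel (a : Fˣ) :
    (genericClass {(linLabel a, 1)}).1 = matClass !![(a : F)] := by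
  rw [genericClass_singleton, matClass_jordanBlock_of_natDegree_eq_one] <;> simp [linLabel]

theorem genericClass_linLabel_two (a : Fˣ) :
    (genericClass {(linLabel a, 2)}).1 = matClass !![0, -(a * a : F); 1, (a : F) + a] := by
  rw [genericClass_singleton]
  have h : ((linLabel a).1 ^ ((2 : ℕ+) : ℕ)) = X ^ 2 + C (-(a + a : F)) * X + C (a * a : F) := by
    simp only [linLabel, PNat.val_ofNat, C_neg, C_add, C_mul]
    ring
  rw [h, matClass_jordanBlock_of_natDegree_eq_two (by compute_degree!)]
  simp [coeff_X]

theorem genericClass_quadLabel (b : F) (c : IrredSet b) :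
    (genericClass {(quadLabel b c, 1)}).1 = matClass !![0, -b; 1, -c.1] := by
  rw [genericClass_singleton]
  have h : ((quadLabel b c).1 ^ ((1 : ℕ+) : ℕ)) = X ^ 2 + C c.1 * X + C b := by
    simp [quadLabel]
  rw [h, matClass_jordanBlock_of_natDegree_eq_two (by compute_degree!)]
  simp [coeff_X]

/-- The case x = y is included: the type attached to the multiset still has two elements. An
arbitrary enumeration lists x and y in one of two orders, and a swap corrects the wrong one. -/
theorem exists_equiv_toType_pair {α : Type*} [DecidableEq α] (x y : α) :
    ∃ σ : Fin 2 ≃ Multiset.ToType ({x, y} : Multiset α), (σ 0).1 = x ∧ (σ 1).1 = y := by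
  have hc : Fintype.card (Multiset.ToType ({x, y} : Multiset α)) = Fintype.card (Fin 2) := by
    rw [Multiset.card_coe]; simp
  let σ := (Fintype.equivOfCardEq hc).symm
  have h : ({x, y} : Multiset α) = {(σ 0).1, (σ 1).1} := by
    conv_lhs => rw [← Multiset.map_univ_coe ({x, y} : Multiset α)]
    rw [← Finset.map_univ_equiv σ]
    rfl
  have h' : (x = (σ 0).1 ∧ y = (σ 1).1) ∨ (x = (σ 1).1 ∧ y = (σ 0).1) := by
    generalize (σ 0).1 = p at h
    generalize (σ 1).1 = r at h
    have hx : x ∈ ({p, r} : Multiset α) := h ▸ by simp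
    rcases Multiset.mem_cons.1 hx with rfl | hx
    · exact Or.inl ⟨rfl, Multiset.singleton_inj.1 ((Multiset.cons_inj_right x).1 h)⟩
    · obtain rfl := Multiset.mem_singleton.1 hx
      rw [Multiset.pair_comm p x] at h
      exact Or.inr ⟨rfl, Multiset.singleton_inj.1 ((Multiset.cons_inj_right x).1 h)⟩
  rcases h' with ⟨h1, h2⟩ | ⟨h1, h2⟩
  · exact ⟨σ, h1.symm, h2.symm⟩
  · exact ⟨(Equiv.swap 0 1).trans σ, by simpa using h1.symm, by simpa using h2.symm⟩

/-- Both blocks have size one, so the Jordan matrix is diagonal. For a = b this is the scalar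
matrix, that is the partition 1². -/
theorem genericClass_pair (a b : Fˣ) :
    (genericClass {(linLabel a, 1), (linLabel b, 1)}).1 = matClass !![(a : F), 0; 0, (b : F)] := by
  rw [genericClass_val]
  set μ : Polypartition F := {(linLabel a, 1), (linLabel b, 1)} with hμ
  obtain ⟨σ, h0, h1⟩ := exists_equiv_toType_pair (linLabel a, (1 : ℕ+)) (linLabel b, 1)
  have hb0 : μ.block (σ 0) = X - C (a : F) := by
    rw [Polypartition.block, h0]; simp [linLabel]
  have hb1 : μ.block (σ 1) = X - C (b : F) := by
    rw [Polypartition.block, h1]; simp [linLabel]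
  have hd : ∀ k, (μ.block (σ k)).natDegree = 1 := by
    intro k; fin_cases k
    · exact hb0 ▸ natDegree_X_sub_C _
    · exact hb1 ▸ natDegree_X_sub_C _
  let τ : Fin 2 ≃ μ.Index := Equiv.ofBijective (fun k => ⟨σ k, ⟨0, by rw [hd]; exact one_pos⟩⟩) (by
    constructor
    · intro k l h
      exact σ.injective (congrArg Sigma.fst h)
    · rintro ⟨x, i⟩
      obtain ⟨k, rfl⟩ := σ.surjective x
      refine ⟨k, ?_⟩
      have h := i.2
      have h' := hd k
      exact Sigma.ext rfl (heq_of_eq (Fin.ext (by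
        change 0 = (i : ℕ)
        omega))))
  have hentry : ∀ k, μ.jordan (τ k) (τ k) = -(μ.block (σ k)).coeff 0 := by
    intro k
    change Matrix.blockDiagonal' _ ⟨σ k, _⟩ ⟨σ k, _⟩ = _
    rw [Matrix.blockDiagonal'_apply_eq, jordanBlock, if_pos (by simp [hd])]
  have hne : ∀ k l, k ≠ l → μ.jordan (τ k) (τ l) = 0 := fun k l h =>
    Matrix.blockDiagonal'_apply_ne _ _ _ (σ.injective.ne h)
  refine (matClass_reindex τ _ _ fun k l => ?_).symm
  fin_cases k <;> fin_cases l
  · refine Eq.trans ?_ (hentry 0).symm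
    simp [hb0]
  · exact (hne 0 1 (by decide)).symm
  · exact (hne 1 0 (by decide)).symm
  · refine Eq.trans ?_ (hentry 1).symm
    simp [hb1]

end matClass

/-! ### Sorting the 2 × 2 matrices by trace, and the product formulas. -/

section traces

variable {F : Type*} [Field F]

theorem irreducible_quadratic_iff (c p : F) :
    Irreducible (X ^ 2 + C c * X + C p : F[X]) ↔ ∀ r : F, r ^ 2 + c * r + p ≠ 0 := by
  have hd : (X ^ 2 + C c * X + C p : F[X]).natDegree = 2 := by compute_degree!
  have hm : (X ^ 2 + C c * X + C p : F[X]).Monic := by monicity!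
  rw [hm.irreducible_iff_roots_eq_zero_of_degree_le_three (by omega) (by omega),
    Multiset.eq_zero_iff_forall_notMem]
  refine forall_congr' fun r => ?_
  rw [mem_roots hm.ne_zero, IsRoot.def]
  simp

/-- The map d ↦ a b⁻¹ d⁻¹ exchanges the two roots a d⁻¹ and b d; its fixed points correspond to
double roots. -/
theorem mul_sq_eq_iff {M : Type*} [CommGroup M] (a b d : M) :
    b * d ^ 2 = a ↔ d = a * b⁻¹ * d⁻¹ := by
  rw [eq_mul_inv_iff_mul_eq, eq_mul_inv_iff_mul_eq, sq, mul_comm b]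

variable [Fintype F] {A : Type*} [AddCommGroup A]

open Classical in
theorem sum_irredSet (p : F) (G : F → A) : ∑ c : IrredSet p, G (-c.1) =
    ∑ τ : F, if Irreducible (X ^ 2 + C (-τ) * X + C p : F[X]) then G τ else 0 := by
  rw [← Finset.sum_filter]
  refine Finset.sum_bij' (fun c _ => -c.1) (fun τ hτ => ⟨-τ, (Finset.mem_filter.1 hτ).2⟩)
    ?_ ?_ ?_ ?_ ?_
  · intro c _
    have := c.2
    simpa using this
  · exact fun _ _ => Finset.mem_univ _
  · exact fun c _ => Subtype.ext (neg_neg c.1)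
  · exact fun τ _ => neg_neg τ
  · exact fun _ _ => rfl

variable [Module ℂ A]

/-- The traces of the invertible matrices of order two with a given determinant, sorted by the type
of the characteristic polynomial: irreducible, with two distinct roots, with a double root. -/
theorem sum_traces [DecidableEq F] (a b : Fˣ) (G : F → A) :
    ∑ τ, G τ = ∑ c : IrredSet ((a * b : Fˣ) : F), G (-c.1) +
      (1 / 2 : ℂ) • (∑ d : Fˣ with b * d ^ 2 ≠ a, G ((a * d⁻¹ : Fˣ) + (b * d : Fˣ))) +
      ∑ d : Fˣ with b * d ^ 2 = a, G ((a * d⁻¹ : Fˣ) + (b * d : Fˣ)) := by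
  classical
  -- These weights make every reducible polynomial count once: two values of d of weight 1/2 for
  -- distinct roots, one of weight 1 for a double root.
  set w : Fˣ → ℂ := fun d => if b * d ^ 2 = a then 1 else 1 / 2 with hw
  set T : Fˣ → F := fun d => (a * d⁻¹ : Fˣ) + (b * d : Fˣ) with hT
  have h1 : (1 / 2 : ℂ) • (∑ d : Fˣ with b * d ^ 2 ≠ a, G (T d)) +
      ∑ d : Fˣ with b * d ^ 2 = a, G (T d) = ∑ d, w d • G (T d) := by
    rw [← Finset.sum_filter_add_sum_filter_not Finset.univ (fun d : Fˣ => b * d ^ 2 = a)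
      (fun d => w d • G (T d)), add_comm, Finset.smul_sum]
    congr 1
    · refine Finset.sum_congr rfl fun d hd => ?_
      simp only [hw, (Finset.mem_filter.1 hd).2, if_true, one_smul]
    · refine Finset.sum_congr rfl fun d hd => ?_
      simp only [hw, if_neg (Finset.mem_filter.1 hd).2]
  -- The trace is τ exactly when b d is a root of X² - τX + ab; the other root is then a d⁻¹.
  have hroot : ∀ (τ : F) (d : Fˣ), T d = τ ↔
      ((b * d : Fˣ) : F) ^ 2 + (-τ) * (b * d : Fˣ) + (a * b : Fˣ) = 0 := by
    intro τ d
    have hd := d.ne_zero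
    have hb := b.ne_zero
    simp only [hT, Units.val_mul, Units.val_inv_eq_inv_val]
    constructor
    · rintro rfl
      field_simp
      ring
    · intro h
      have : (b : F) * d * (a * (d : F)⁻¹ + b * d - τ) = 0 := by
        rw [← h]; field_simp; ring
      rcases mul_eq_zero.1 this with h | h
      · exact absurd h (mul_ne_zero hb hd)
      · exact sub_eq_zero.1 h
  have h2 : ∀ τ : F, ∑ d with T d = τ, w d =
      if Irreducible (X ^ 2 + C (-τ) * X + C ((a * b : Fˣ) : F) : F[X]) then 0 else 1 := by
    intro τ
    split_ifs with hi
    · rw [irreducible_quadratic_iff] at hi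
      rw [Finset.filter_false_of_mem, Finset.sum_empty]
      exact fun d _ h => hi _ ((hroot τ d).1 h)
    · rw [irreducible_quadratic_iff] at hi
      push Not at hi
      obtain ⟨r, hr⟩ := hi
      have hr0 : r ≠ 0 := by
        rintro rfl
        simp at hr
      -- The constant term ab is nonzero, so a root is a unit and can be written b d₀.
      obtain ⟨d₀, rfl⟩ : ∃ d₀ : Fˣ, ((b * d₀ : Fˣ) : F) = r :=
        ⟨b⁻¹ * Units.mk0 r hr0, by simp⟩
      have hd₀ := (hroot τ d₀).2 hr
      have hfil : (Finset.univ.filter fun d => T d = τ) = {d₀, a * b⁻¹ * d₀⁻¹} := by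
        ext d
        simp only [Finset.mem_filter, Finset.mem_univ, true_and, Finset.mem_insert,
          Finset.mem_singleton]
        rw [← hd₀]
        have hd1 := d.ne_zero
        have hd2 := d₀.ne_zero
        have hb := b.ne_zero
        rw [Units.ext_iff, Units.ext_iff]
        simp only [hT, Units.val_mul, Units.val_inv_eq_inv_val]
        constructor
        · intro h
          have : ((d : F) - d₀) * (d - a * (b : F)⁻¹ * (d₀ : F)⁻¹) = 0 := by
            have h' : (a * (d : F)⁻¹ + b * d - (a * (d₀ : F)⁻¹ + b * d₀)) * (d * (b : F)⁻¹) = 0 := by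
              rw [h, sub_self, zero_mul]
            rw [← h']
            field_simp
            ring
          rcases mul_eq_zero.1 this with h | h
          · exact Or.inl (sub_eq_zero.1 h)
          · exact Or.inr (sub_eq_zero.1 h)
        · have ha := a.ne_zero
          rintro (h | h)
          · rw [h]
          · rw [h]
            field_simp
            ring
      rw [hfil]
      by_cases hdd : d₀ = a * b⁻¹ * d₀⁻¹
      · rw [← hdd, Finset.pair_eq_singleton, Finset.sum_singleton]
        simp only [hw]
        rw [if_pos ((mul_sq_eq_iff a b d₀).2 hdd)]
      · rw [Finset.sum_pair hdd]
        simp only [hw]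
        rw [if_neg fun h => hdd ((mul_sq_eq_iff a b d₀).1 h), if_neg]
        · norm_num
        · intro h
          rw [mul_sq_eq_iff] at h
          exact hdd (h.trans (by rw [mul_inv, inv_inv, mul_inv_cancel_left])).symm
  rw [sum_irredSet, add_assoc, h1, ← Finset.sum_fiberwise (s := Finset.univ) (g := T),
    ← Finset.sum_add_distrib]
  refine Finset.sum_congr rfl fun τ _ => ?_
  rw [Finset.sum_congr rfl (g := fun d => w d • G τ) fun d hd => by
    rw [(Finset.mem_filter.1 hd).2], ← Finset.sum_smul, h2]
  split_ifs <;> simp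

/-- The class of the companion matrix of `X ^ 2 - τ X + p`. -/
def companionClass (p τ : F) : ∀ n, PartIsoAlg F n := matClass !![0, -p; 1, τ]

/-- Since 1 - a and 1 - b are invertible, x = t(1 - a) and y = s(1 - b) are free coordinates; the
rows y ≠ 0 all contribute alike, and y = 0 is kept apart. -/
theorem sum_matClass_shear [DecidableEq F] {a b : F} (ha : a ≠ 1) (hb : b ≠ 1) {q : ℂ}
    (hq : q = Fintype.card F) :
    ∑ t, ∑ s, matClass !![a + t * (1 - a) * (s * (1 - b)), t * (1 - a) * b; s * (1 - b), b] =
      (q - 1) • ∑ τ, companionClass (a * b) τ + ∑ x, matClass !![a, x * b; 0, b] := by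
  have ha' : 1 - a ≠ 0 := sub_ne_zero.2 ha.symm
  have hb' : 1 - b ≠ 0 := sub_ne_zero.2 hb.symm
  have h1 : ∑ t, ∑ s, matClass !![a + t * (1 - a) * (s * (1 - b)), t * (1 - a) * b;
      s * (1 - b), b] = ∑ y, ∑ x, matClass !![a + x * y, x * b; y, b] := by
    refine Finset.sum_comm.trans (Fintype.sum_equiv (Equiv.mulRight₀ (1 - b) hb') _ _ fun s =>
      Fintype.sum_equiv (Equiv.mulRight₀ (1 - a) ha') _ _ fun t => ?_)
    simp only [Equiv.mulRight₀_apply]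
  have h2 : ∀ y ∈ Finset.univ.erase (0 : F), ∑ x, matClass !![a + x * y, x * b; y, b] =
      ∑ τ, companionClass (a * b) τ := by
    intro y hy
    have hy := Finset.ne_of_mem_erase hy
    -- For fixed y ≠ 0, the trace a + b + xy is a bijective function of x, while the determinant
    -- stays equal to ab.
    refine Fintype.sum_equiv ((Equiv.mulRight₀ y hy).trans (Equiv.addLeft (a + b))) _ _ fun x => ?_
    rw [matClass_eq_companion (Or.inr (Or.inl hy)), companionClass]
    simp only [Equiv.trans_apply, Equiv.mulRight₀_apply, Equiv.coe_addLeft]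
    rw [show (a + x * y) * b - x * b * y = a * b by ring,
      show a + x * y + b = a + b + x * y by ring]
  rw [h1, ← Finset.sum_erase_add _ _ (Finset.mem_univ (0 : F)), Finset.sum_congr rfl h2,
    Finset.sum_const, Finset.card_erase_of_mem (Finset.mem_univ _), Finset.card_univ,
    ← Nat.cast_smul_eq_nsmul ℂ, Nat.cast_sub Fintype.card_pos, Nat.cast_one, ← hq]
  simp only [mul_zero, add_zero]

theorem sum_matClass_upper_of_ne {a b : F} (hab : a ≠ b) {q : ℂ} (hq : q = Fintype.card F) :
    ∑ x : F, matClass !![a, x * b; 0, b] = q • companionClass (a * b) (a + b) := by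
  rw [Finset.sum_congr rfl fun x _ => matClass_eq_companion (Or.inr (Or.inr hab)), hq,
    Nat.cast_smul_eq_nsmul, ← Finset.card_univ, ← Finset.sum_const]
  simp [companionClass]

theorem sum_matClass_upper_self [DecidableEq F] {a : F} (ha : a ≠ 0) {q : ℂ}
    (hq : q = Fintype.card F) :
    ∑ x : F, matClass !![a, x * a; 0, a] =
      (q - 1) • companionClass (a * a) (a + a) + matClass !![a, 0; 0, a] := by
  have h2 : ∀ x ∈ Finset.univ.erase (0 : F), matClass !![a, x * a; 0, a] =
      companionClass (a * a) (a + a) := by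
    intro x hx
    rw [matClass_eq_companion (Or.inl (mul_ne_zero (Finset.ne_of_mem_erase hx) ha)),
      companionClass]
    simp
  rw [← Finset.sum_erase_add _ _ (Finset.mem_univ (0 : F)), Finset.sum_congr rfl h2,
    Finset.sum_const, Finset.card_erase_of_mem (Finset.mem_univ _), Finset.card_univ,
    ← Nat.cast_smul_eq_nsmul ℂ, Nat.cast_sub Fintype.card_pos, Nat.cast_one, ← hq, zero_mul]

theorem mul_inv_eq_mul_of_mul_sq_eq {M : Type*} [CommGroup M] {a b d : M} (h : b * d ^ 2 = a) :
    a * d⁻¹ = b * d := by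
  rw [mul_inv_eq_iff_eq_mul, mul_assoc, ← sq, h]

theorem genericClass_pair_of_ne {c d : Fˣ} (h : c ≠ d) :
    (genericClass {(linLabel c, 1), (linLabel d, 1)}).1 =
      companionClass ((c * d : Fˣ) : F) ((c : F) + d) := by
  rw [genericClass_pair, matClass_eq_companion (Or.inr (Or.inr fun h' => h (Units.ext h'))),
    companionClass]
  simp

theorem sum_genericClass_quadLabel (p : F) :
    ∑ c : IrredSet p, (genericClass {(quadLabel p c, 1)}).1 =
      ∑ c : IrredSet p, companionClass p (-c.1) :=
  Finset.sum_congr rfl fun c _ => genericClass_quadLabel p c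

theorem genericClass_linLabel_two' (a : Fˣ) :
    (genericClass {(linLabel a, 2)}).1 = companionClass ((a * a : Fˣ) : F) ((a : F) + a) := by
  rw [genericClass_linLabel_two, companionClass]
  simp

/-- The classes of the semisimple matrices with distinct eigenvalues in `F` and a given
determinant. -/
theorem sum_genericClass_pair (a b : Fˣ) (s : Finset Fˣ) (hs : ∀ d ∈ s, b * d ^ 2 ≠ a) :
    ∑ d ∈ s, (genericClass {(linLabel (a * d⁻¹), 1), (linLabel (b * d), 1)}).1 =
      ∑ d ∈ s, companionClass ((a * b : Fˣ) : F) ((a * d⁻¹ : Fˣ) + (b * d : Fˣ)) := by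
  refine Finset.sum_congr rfl fun d hd => ?_
  rw [genericClass_pair_of_ne]
  · congr 2
    rw [mul_mul_mul_comm, inv_mul_cancel, mul_one]
  · intro h
    refine hs d hd ?_
    rw [mul_inv_eq_iff_eq_mul] at h
    rw [h, sq, mul_assoc]

/-- The double roots are left as a sum over the solutions of b d² = a, so that the three cases
differ only in the list of these solutions. -/
theorem product_of_ne [DecidableEq F] {a b : Fˣ} (hab : a ≠ b) (ha : a ≠ 1) (hb : b ≠ 1) {q : ℂ}
    (hq : q = Fintype.card F) :
    (genericClass {(linLabel a, 1)}).1 * (genericClass {(linLabel b, 1)}).1 =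
      ((q - 1) / q ^ 2) •
        ((∑ d : Fˣ with b * d ^ 2 = a, (genericClass {(linLabel (b * d), 2)}).1)
          + ∑ c : IrredSet ((a * b : Fˣ) : F), (genericClass {(quadLabel _ c, 1)}).1
          + (1 / 2 : ℂ) • ∑ d ∈ (Finset.univ.filter fun d : Fˣ => b * d ^ 2 ≠ a) \ {1, b⁻¹ * a},
              (genericClass {(linLabel (a * d⁻¹), 1), (linLabel (b * d), 1)}).1)
        + ((2 * q - 1) / q ^ 2) • (genericClass {(linLabel a, 1), (linLabel b, 1)}).1
        + (q - 1) • (genericClass {(linLabel (a * b), 1)}).1 := by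
  have hab' : (a : F) ≠ b := fun h => hab (Units.ext h)
  have ha' : (a : F) ≠ 1 := fun h => ha (Units.ext h)
  have hb' : (b : F) ≠ 1 := fun h => hb (Units.ext h)
  have hq0 : q ≠ 0 := by rw [hq]; exact_mod_cast Fintype.card_ne_zero
  have hsub : ({1, b⁻¹ * a} : Finset Fˣ) ⊆ Finset.univ.filter fun d : Fˣ => b * d ^ 2 ≠ a := by
    intro d hd
    rw [Finset.mem_filter]
    refine ⟨Finset.mem_univ _, fun h => hab ?_⟩
    rcases Finset.mem_insert.1 hd with rfl | hd
    · simpa using h.symm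
    · have h := mul_inv_eq_mul_of_mul_sq_eq h
      rw [Finset.mem_singleton.1 hd, mul_inv, inv_inv, mul_inv_cancel_left, mul_comm b,
        mul_inv_cancel_left] at h
      exact h.symm
  have hdouble : ∑ d : Fˣ with b * d ^ 2 = a, (genericClass {(linLabel (b * d), 2)}).1 =
      ∑ d : Fˣ with b * d ^ 2 = a,
        companionClass ((a * b : Fˣ) : F) ((a * d⁻¹ : Fˣ) + (b * d : Fˣ)) := by
    refine Finset.sum_congr rfl fun d hd => ?_
    have h := mul_inv_eq_mul_of_mul_sq_eq (Finset.mem_filter.1 hd).2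
    have h' : b * d * (b * d) = a * b := by
      calc b * d * (b * d) = a * d⁻¹ * (b * d) := by rw [h]
        _ = a * b := by rw [mul_mul_mul_comm, inv_mul_cancel, mul_one]
    rw [genericClass_linLabel_two', h, h']
  have h1 := sum_traces a b (companionClass (F := F) ((a * b : Fˣ) : F))
  have hne : (1 : Fˣ) ≠ b⁻¹ * a := fun h => hab (inv_mul_eq_one.1 h.symm).symm
  -- The values d = 1 and d = b⁻¹ a both give the roots a, b, a class that also arises from the row
  -- y = 0.
  have e1 : ((a * 1⁻¹ : Fˣ) : F) + (b * 1 : Fˣ) = a + b := by simp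
  have e2 : ((a * (b⁻¹ * a)⁻¹ : Fˣ) : F) + (b * (b⁻¹ * a) : Fˣ) = a + b := by
    rw [mul_inv, inv_inv, mul_comm b a⁻¹, mul_inv_cancel_left, mul_inv_cancel_left, add_comm]
  rw [← Finset.sum_sdiff hsub, Finset.sum_pair hne, e1, e2] at h1
  rw [genericClass_linLabel, genericClass_linLabel, genericClass_linLabel,
    matClass_mul_matClass a.ne_zero b.ne_zero hq, sum_matClass_shear ha' hb' hq,
    sum_matClass_upper_of_ne hab' hq, genericClass_pair_of_ne hab, hdouble,
    sum_genericClass_quadLabel, sum_genericClass_pair _ _ _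
      fun d hd => (Finset.mem_filter.1 (Finset.mem_sdiff.1 hd).1).2, ← Units.val_mul, h1]
  generalize (∑ c : IrredSet ((a * b : Fˣ) : F), companionClass ((a * b : Fˣ) : F) (-c.1)) = x₁
  generalize (∑ d ∈ (_ \ _ : Finset Fˣ), companionClass ((a * b : Fˣ) : F) _) = x₂
  generalize (∑ d ∈ _, companionClass ((a * b : Fˣ) : F) _) = x₃
  -- The class with roots a, b has coefficient (q - 1)/q² from its two halves and q/q² from y = 0,
  -- in total (2q - 1)/q².
  match_scalars <;> field_simp
  ring

/-- The Jordan block of a arises twice with weight q - 1: from d = 1 among the traces, and from the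
nonzero entries in the row y = 0. The zero entry of that row gives the scalar matrix. -/
theorem product_of_eq [DecidableEq F] {a : Fˣ} (ha : a ≠ 1) {q : ℂ} (hq : q = Fintype.card F) :
    (genericClass {(linLabel a, 1)}).1 * (genericClass {(linLabel a, 1)}).1 =
      ((q - 1) / q ^ 2) •
        ((genericClass {(linLabel a, 2)}).1
          + (∑ d : Fˣ with d ^ 2 = 1, (genericClass {(linLabel (a * d), 2)}).1)
          + ∑ c : IrredSet ((a ^ 2 : Fˣ) : F), (genericClass {(quadLabel _ c, 1)}).1
          + (1 / 2 : ℂ) • ∑ d : Fˣ with d ^ 2 ≠ 1,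
              (genericClass {(linLabel (a * d⁻¹), 1), (linLabel (a * d), 1)}).1)
        + (1 / q ^ 2) • (genericClass {(linLabel a, 1), (linLabel a, 1)}).1
        + (q - 1) • (genericClass {(linLabel (a ^ 2), 1)}).1 := by
  have ha' : (a : F) ≠ 1 := fun h => ha (Units.ext h)
  have hq0 : q ≠ 0 := by rw [hq]; exact_mod_cast Fintype.card_ne_zero
  have hiff : ∀ d : Fˣ, a * d ^ 2 = a ↔ d ^ 2 = 1 := fun d => mul_eq_left
  have hdouble : ∑ d : Fˣ with d ^ 2 = 1, (genericClass {(linLabel (a * d), 2)}).1 =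
      ∑ d : Fˣ with d ^ 2 = 1,
        companionClass ((a * a : Fˣ) : F) ((a * d⁻¹ : Fˣ) + (a * d : Fˣ)) := by
    refine Finset.sum_congr rfl fun d hd => ?_
    have h := mul_inv_eq_mul_of_mul_sq_eq ((hiff d).2 (Finset.mem_filter.1 hd).2)
    have h' : a * d * (a * d) = a * a := by
      calc a * d * (a * d) = a * d⁻¹ * (a * d) := by rw [h]
        _ = a * a := by rw [mul_mul_mul_comm, inv_mul_cancel, mul_one]
    rw [genericClass_linLabel_two', h, h']
  have h1 := sum_traces a a (companionClass (F := F) ((a * a : Fˣ) : F))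
  simp only [ne_eq, hiff] at h1
  rw [sq a, genericClass_linLabel, genericClass_linLabel,
    matClass_mul_matClass a.ne_zero a.ne_zero hq, sum_matClass_shear ha' ha' hq,
    sum_matClass_upper_self a.ne_zero hq, genericClass_pair, hdouble,
    sum_genericClass_quadLabel, sum_genericClass_pair a a (Finset.univ.filter fun d => ¬ d ^ 2 = 1)
      fun d hd h => (Finset.mem_filter.1 hd).2 ((hiff d).1 h), ← Units.val_mul, h1,
    genericClass_linLabel_two']
  generalize (∑ c : IrredSet ((a * a : Fˣ) : F), companionClass ((a * a : Fˣ) : F) (-c.1)) = x₁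
  generalize (∑ d : Fˣ with d ^ 2 = 1, companionClass ((a * a : Fˣ) : F) _) = x₂
  generalize (∑ d ∈ _, companionClass ((a * a : Fˣ) : F) _) = x₃
  match_scalars <;> field_simp

theorem product_of_one_right {a : Fˣ} {q : ℂ} (hq : q = Fintype.card F) :
    (genericClass {(linLabel a, 1)}).1 * (genericClass {(linLabel 1, 1)}).1 =
      (genericClass {(linLabel a, 1), (linLabel 1, 1)}).1 +
        (q - 1) • (genericClass {(linLabel a, 1)}).1 := by
  have hq0 : q ≠ 0 := by rw [hq]; exact_mod_cast Fintype.card_ne_zero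
  have h : ∀ t : F, matClass !![(a : F), t * (1 - a); 0, 1] = matClass !![(a : F), 0; 0, 1] := by
    intro t
    -- The columns (1, 0) and (t, 1) are eigenvectors for a and 1, even when a = 1. All q² matrices
    -- thus have the same class, which cancels the factor q⁻².
    refine matClass_eq_of_conj !![1, t; 0, 1] _ _ (by rw [Matrix.isUnit_iff_isUnit_det]; simp) ?_
    ext i j; fin_cases i <;> fin_cases j <;> simp [Matrix.mul_apply, Fin.sum_univ_two]
    ring
  rw [genericClass_linLabel, genericClass_linLabel, genericClass_pair,
    matClass_mul_matClass a.ne_zero (Units.ne_zero 1) hq]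
  simp only [Units.val_one, sub_self, mul_zero, mul_one, add_zero, h, Finset.sum_const,
    Finset.card_univ, ← Nat.cast_smul_eq_nsmul ℂ, ← hq]
  match_scalars <;> field_simp

theorem product_of_one_left {a : Fˣ} {q : ℂ} (hq : q = Fintype.card F) :
    (genericClass {(linLabel 1, 1)}).1 * (genericClass {(linLabel a, 1)}).1 =
      (genericClass {(linLabel a, 1), (linLabel 1, 1)}).1 +
        (q - 1) • (genericClass {(linLabel a, 1)}).1 := by
  have hq0 : q ≠ 0 := by rw [hq]; exact_mod_cast Fintype.card_ne_zero
  have h : ∀ t : F, matClass !![1, 0; t * (1 - a), (a : F)] = matClass !![(a : F), 0; 0, 1] := by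
    intro t
    -- The columns (0, 1) and (1, t) are eigenvectors for a and 1, in the order of the diagonal
    -- matrix.
    refine matClass_eq_of_conj !![0, 1; 1, t] _ _ (by rw [Matrix.isUnit_iff_isUnit_det]; simp) ?_
    ext i j; fin_cases i <;> fin_cases j <;> simp [Matrix.mul_apply, Fin.sum_univ_two]
    ring
  rw [genericClass_linLabel, genericClass_linLabel, genericClass_pair,
    matClass_mul_matClass (Units.ne_zero 1) a.ne_zero hq]
  simp only [Units.val_one, sub_self, mul_zero, one_mul, zero_mul, add_zero, h, Finset.sum_const,
    Finset.card_univ, ← Nat.cast_smul_eq_nsmul ℂ, ← hq]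
  match_scalars <;> field_simp

end traces

theorem coe_sum_genericAlg {F : Type*} [Field F] [Fintype F] {α : Type*} (s : Finset α)
    (x : α → GenericAlg F) :
    ((∑ i ∈ s, x i : GenericAlg F) : ∀ n, PartIsoAlg F n) = ∑ i ∈ s, (x i).1 :=
  AddSubmonoidClass.coe_finsetSum x s

/-! ### The solutions of b d² = a according to the parity of q. -/

section roots

variable {F : Type*} [Field F]

/-- Multiplied by b, the equation reads (b d)² = δ². The two solutions coincide when q is even. -/
theorem mul_sq_eq_iff_eq_or_eq_neg {a b δ : Fˣ} (h : a * b = δ ^ 2) (d : Fˣ) :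
    b * d ^ 2 = a ↔ d = b⁻¹ * δ ∨ d = -(b⁻¹ * δ) := by
  have h1 : b * d ^ 2 = a ↔ (b * d) ^ 2 = δ ^ 2 := by
    rw [← h, mul_pow, sq b, mul_assoc, mul_comm a b, mul_right_inj]
  rw [h1, ← mul_neg, eq_inv_mul_iff_mul_eq, eq_inv_mul_iff_mul_eq]
  constructor
  · exact Units.eq_or_eq_neg_of_sq_eq_sq _ _
  · rintro (h | h) <;> rw [h]
    rw [neg_sq]

theorem units_neg_ne_self_of_odd [Fintype F] (h : Odd (Fintype.card F)) (δ : Fˣ) : -δ ≠ δ := by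
  intro h'
  have h2 : ringChar F ≠ 2 := fun hc => by
    rw [FiniteField.even_card_iff_char_two] at hc
    rw [Nat.odd_iff] at h
    omega
  exact δ.ne_zero ((Ring.eq_self_iff_eq_zero_of_char_ne_two h2).1
    (by simpa using congrArg Units.val h'))

theorem units_neg_eq_self_of_even [Fintype F] (h : Even (Fintype.card F)) (δ : Fˣ) : -δ = δ := by
  have h2 : ringChar F = 2 := FiniteField.even_card_iff_char_two.2 (Nat.even_iff.1 h)
  have : CharP F 2 := ringChar.of_eq h2
  exact Units.ext (CharTwo.neg_eq (δ : F))

end roots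

end

theorem mainTheorem8 {F : Type*} [Field F] [Fintype F] [DecidableEq F] (q : ℂ)
    (hq : q = Fintype.card F) (a b : Fˣ) :
    -- `a ≠ b`, both different from `1`, `q` odd, `ab = δ ^ 2`
    (a ≠ b → a ≠ 1 → b ≠ 1 → Odd (Fintype.card F) → ∀ δ : Fˣ, a * b = δ ^ 2 →
      (genericClass {(linLabel a, 1)}).1 * (genericClass {(linLabel b, 1)}).1 =
        (((q - 1) / q ^ 2) • (genericClass {(linLabel δ, 2)} + genericClass {(linLabel (-δ), 2)}
            + ∑ c : IrredSet ((a * b : Fˣ) : F), genericClass {(quadLabel _ c, 1)}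
            + (1 / 2 : ℂ) • ∑ d ∈ Finset.univ \ {1, b⁻¹ * a, b⁻¹ * δ, -(b⁻¹ * δ)},
                genericClass {(linLabel (a * d⁻¹), 1), (linLabel (b * d), 1)})
          + ((2 * q - 1) / q ^ 2) • genericClass {(linLabel a, 1), (linLabel b, 1)}
          + (q - 1) • genericClass {(linLabel (a * b), 1)}).1) ∧
    -- `a ≠ b`, both different from `1`, `q` odd, `ab` not a square
    (a ≠ b → a ≠ 1 → b ≠ 1 → Odd (Fintype.card F) → ¬ IsSquare (a * b) →
      (genericClass {(linLabel a, 1)}).1 * (genericClass {(linLabel b, 1)}).1 =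
        (((q - 1) / q ^ 2) • (∑ c : IrredSet ((a * b : Fˣ) : F), genericClass {(quadLabel _ c, 1)}
            + (1 / 2 : ℂ) • ∑ d ∈ Finset.univ \ {1, b⁻¹ * a},
                genericClass {(linLabel (a * d⁻¹), 1), (linLabel (b * d), 1)})
          + ((2 * q - 1) / q ^ 2) • genericClass {(linLabel a, 1), (linLabel b, 1)}
          + (q - 1) • genericClass {(linLabel (a * b), 1)}).1) ∧
    -- `a ≠ b`, both different from `1`, `q` even, `δ = (ab) ^ (q / 2)`
    (a ≠ b → a ≠ 1 → b ≠ 1 → Even (Fintype.card F) → ∀ δ : Fˣ,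
      δ = (a * b) ^ (Fintype.card F / 2) →
      (genericClass {(linLabel a, 1)}).1 * (genericClass {(linLabel b, 1)}).1 =
        (((q - 1) / q ^ 2) • (genericClass {(linLabel δ, 2)}
            + ∑ c : IrredSet ((a * b : Fˣ) : F), genericClass {(quadLabel _ c, 1)}
            + (1 / 2 : ℂ) • ∑ d ∈ Finset.univ \ {1, b⁻¹ * a, b⁻¹ * δ},
                genericClass {(linLabel (a * d⁻¹), 1), (linLabel (b * d), 1)})
          + ((2 * q - 1) / q ^ 2) • genericClass {(linLabel a, 1), (linLabel b, 1)}
          + (q - 1) • genericClass {(linLabel (a * b), 1)}).1) ∧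
    -- `a = b ≠ 1`, `q` odd
    (a = b → a ≠ 1 → Odd (Fintype.card F) →
      (genericClass {(linLabel a, 1)}).1 * (genericClass {(linLabel b, 1)}).1 =
        (((q - 1) / q ^ 2) • ((2 : ℂ) • genericClass {(linLabel a, 2)} + genericClass {(linLabel (-a), 2)}
            + ∑ c : IrredSet ((a ^ 2 : Fˣ) : F), genericClass {(quadLabel _ c, 1)}
            + (1 / 2 : ℂ) • ∑ d ∈ Finset.univ \ {1, -1},
                genericClass {(linLabel (a * d⁻¹), 1), (linLabel (a * d), 1)})
          + (1 / q ^ 2) • genericClass {(linLabel a, 1), (linLabel a, 1)}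
          + (q - 1) • genericClass {(linLabel (a ^ 2), 1)}).1) ∧
    -- `a = b ≠ 1`, `q` even
    (a = b → a ≠ 1 → Even (Fintype.card F) →
      (genericClass {(linLabel a, 1)}).1 * (genericClass {(linLabel b, 1)}).1 =
        (((q - 1) / q ^ 2) • ((2 : ℂ) • genericClass {(linLabel a, 2)}
            + ∑ c : IrredSet ((a ^ 2 : Fˣ) : F), genericClass {(quadLabel _ c, 1)}
            + (1 / 2 : ℂ) • ∑ d ∈ Finset.univ \ {1},
                genericClass {(linLabel (a * d⁻¹), 1), (linLabel (a * d), 1)})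
          + (1 / q ^ 2) • genericClass {(linLabel a, 1), (linLabel a, 1)}
          + (q - 1) • genericClass {(linLabel (a ^ 2), 1)}).1) ∧
    -- `a ≠ 1`, `b = 1`, in both orders
    (a ≠ 1 → b = 1 →
      (genericClass {(linLabel a, 1)}).1 * (genericClass {(linLabel b, 1)}).1 =
        (genericClass {(linLabel a, 1), (linLabel 1, 1)} + (q - 1) • genericClass {(linLabel a, 1)}).1 ∧
      (genericClass {(linLabel b, 1)}).1 * (genericClass {(linLabel a, 1)}).1 =
        (genericClass {(linLabel a, 1), (linLabel 1, 1)} + (q - 1) • genericClass {(linLabel a, 1)}).1) ∧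
    -- `a = b = 1`
    (a = 1 → b = 1 →
      (genericClass {(linLabel a, 1)}).1 * (genericClass {(linLabel b, 1)}).1 =
        (genericClass {(linLabel 1, 1), (linLabel 1, 1)} + (q - 1) • genericClass {(linLabel 1, 1)}).1) := by
  simp only [Submodule.coe_add, Submodule.coe_smul, coe_sum_genericAlg]
  refine ⟨?_, ?_, ?_, ?_, ?_, ?_, ?_⟩
  · intro hab ha hb hodd δ hδ
    have hf := mul_sq_eq_iff_eq_or_eq_neg hδ
    have h1 : (Finset.univ.filter fun d : Fˣ => b * d ^ 2 = a) = {b⁻¹ * δ, -(b⁻¹ * δ)} := by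
      ext d; simp [hf]
    have h2 : (Finset.univ.filter fun d : Fˣ => b * d ^ 2 ≠ a) \ {1, b⁻¹ * a} =
        Finset.univ \ {1, b⁻¹ * a, b⁻¹ * δ, -(b⁻¹ * δ)} := by
      ext d; simp [hf]; tauto
    rw [product_of_ne hab ha hb hq, h1, h2, Finset.sum_pair (units_neg_ne_self_of_odd hodd _).symm,
      mul_neg, mul_inv_cancel_left]
  · intro hab ha hb hodd hsq
    -- A solution d would make ab = (b d)² a square, so there are no double roots.
    have hf : ∀ d : Fˣ, b * d ^ 2 ≠ a := fun d h => hsq ⟨b * d, by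
      rw [← h, ← sq, mul_pow, sq b, mul_right_comm]⟩
    have h1 : (Finset.univ.filter fun d : Fˣ => b * d ^ 2 = a) = ∅ := by
      ext d; simp [hf]
    have h2 : (Finset.univ.filter fun d : Fˣ => b * d ^ 2 ≠ a) = Finset.univ := by
      ext d; simp [hf]
    rw [product_of_ne hab ha hb hq, h1, h2, Finset.sum_empty, zero_add]
  · intro hab ha hb heven δ hδ
    -- For even q, δ² = (ab)^q = ab, by the Frobenius identity x^q = x.
    have hδ' : a * b = δ ^ 2 := by
      rw [hδ, ← pow_mul, Nat.div_mul_cancel heven.two_dvd]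
      exact Units.ext (by rw [Units.val_pow_eq_pow_val, FiniteField.pow_card])
    have hf := mul_sq_eq_iff_eq_or_eq_neg hδ'
    simp only [units_neg_eq_self_of_even heven, or_self] at hf
    have h1 : (Finset.univ.filter fun d : Fˣ => b * d ^ 2 = a) = {b⁻¹ * δ} := by
      ext d; simp [hf]
    have h2 : (Finset.univ.filter fun d : Fˣ => b * d ^ 2 ≠ a) \ {1, b⁻¹ * a} =
        Finset.univ \ {1, b⁻¹ * a, b⁻¹ * δ} := by
      ext d; simp [hf]; tauto
    rw [product_of_ne hab ha hb hq, h1, h2, Finset.sum_singleton, mul_inv_cancel_left]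
  · rintro rfl ha hodd
    have hf : ∀ d : Fˣ, d ^ 2 = 1 ↔ d = 1 ∨ d = -1 := fun d => by
      simpa using mul_sq_eq_iff_eq_or_eq_neg (a := (1 : Fˣ)) (b := 1) (δ := 1) (by simp) d
    have h1 : (Finset.univ.filter fun d : Fˣ => d ^ 2 = 1) = {1, -1} := by
      ext d; simp [hf]
    have h2 : (Finset.univ.filter fun d : Fˣ => d ^ 2 ≠ 1) = Finset.univ \ {1, -1} := by
      ext d; simp [hf]
    rw [product_of_eq ha hq, h1, h2, Finset.sum_pair (units_neg_ne_self_of_odd hodd _).symm,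
      mul_one, mul_neg_one, two_smul, ← add_assoc (genericClass {(linLabel a, 2)}).1]
  · rintro rfl ha heven
    have hf : ∀ d : Fˣ, d ^ 2 = 1 ↔ d = 1 := fun d => by
      simpa [units_neg_eq_self_of_even heven] using
        mul_sq_eq_iff_eq_or_eq_neg (a := (1 : Fˣ)) (b := 1) (δ := 1) (by simp) d
    have h1 : (Finset.univ.filter fun d : Fˣ => d ^ 2 = 1) = {1} := by
      ext d; simp [hf]
    have h2 : (Finset.univ.filter fun d : Fˣ => d ^ 2 ≠ 1) = Finset.univ \ {1} := by
      ext d; simp [hf]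
    rw [product_of_eq ha hq, h1, h2, Finset.sum_singleton, mul_one, two_smul]
  · rintro - rfl
    exact ⟨product_of_one_right hq, product_of_one_left hq⟩
  -- `product_of_one_right` does not require a ≠ 1, so it also covers a = b = 1.
  · rintro rfl rfl
    exact product_of_one_right hq
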